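/- All vector spaces, algebras and tensor products are over $\mathbb{C}$. Let $\mathfrak g=\mathfrak g(C)$ be the Kac–Moody Lie algebra of an arbitrary generalized Cartan matrix $C$ (with a realization of $C$; symmetrizability is not assumed), with Cartan subalgebra $\mathfrak h$ and standard triangular decomposition $\mathfrak g=N^-\oplus\mathfrak h\oplus N^+$. Put $\mathfrak g'=[\mathfrak g,\mathfrak g]$, $\mathfrak h'=\mathfrak h\cap\mathfrak g'$, and fix a subspace $\mathfrak h''$ of $\mathfrak h$ with $\mathfrak h=\mathfrak h'\oplus\mathfrak h''$. Let $A=\mathbb{C}[t_1^{\pm1},\dots,t_n^{\pm1}]$, and let $$\mathfrak g_A=(\mathfrak g'\otimes A)\oplus\mathfrak h'',\qquad \mathfrak h_A=(\mathfrak h'\otimes A)\oplus\mathfrak h''$$ with bracket $[X\otimes p,Y\otimes q]=[X,Y]\otimes pq$, $[h,X\otimes p]=[h,X]\otimes p$, $[h,k]=0$ for $X,Y\in\mathfrak g'$, $p,q\in A$, $h,k\in\mathfrak h''$. For a linear map $\psi:\mathfrak h_A\to\mathbb{C}$ let $M(\psi)=U(\mathfrak g_A)\otimes_{U((N^+\otimes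 A)\oplus\mathfrak h_A)}\mathbb{C}$, where $N^+\otimes A$ acts on $\mathbb{C}$ by $0$ and $\mathfrak h_A$ acts via $\psi$, and let $V(\psi)$ be the unique irreducible quotient of the $\mathfrak g_A$-module $M(\psi)$, that is, its quotient by its largest proper submodule. Let $I_1$ and $I_2$ be ideals of $A$ of finite codimension with $I_1+I_2=A$, and let $\psi_1,\psi_2:\mathfrak h_A\to\mathbb{C}$ be linear maps such that $\psi_i(\mathfrak h'\otimes I_i)=0$ for $i=1,2$. Then $$V(\psi_1+\psi_2)\cong V(\psi_1)\otimes V(\psi_2)$$ as $\mathfrak g_A$-modules. -/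

import Mathlib

open scoped TensorProduct

noncomputable section

namespace LoopKacMoody

/-! ### Generalized Cartan matrices and their realizations -/

/-- Generalized Cartan matrices (not assumed symmetrizable). -/
structure IsGCM {ι : Type*} (C : Matrix ι ι ℤ) : Prop where
  diag : ∀ i, C i i = 2
  nonpos : ∀ i j, i ≠ j → C i j ≤ 0
  zero_symm : ∀ i j, C i j = 0 → C j i = 0

/-- A (minimal) realization of a complex matrix given by integers: a finite dimensional space `H`,
linearly independent simple coroots in `H` and simple roots in the dual of `H`, with
`⟨coroot i, root j⟩ = C i j` and `dim H - l = l - rank C`, where `l` is the size of `C`. -/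
structure Realization {ι : Type*} [Fintype ι] [DecidableEq ι] (C : Matrix ι ι ℤ)
    (H : Type*) [AddCommGroup H] [Module ℂ H] where
  finite : Module.Finite ℂ H
  coroot : ι → H
  root : ι → Module.Dual ℂ H
  coroot_indep : LinearIndependent ℂ coroot
  root_indep : LinearIndependent ℂ root
  pairing : ∀ i j, root j (coroot i) = (C i j : ℂ)
  dim_eq : Module.finrank ℂ H + (C.map (Int.cast : ℤ → ℂ)).rank = 2 * Fintype.card ι

/-- Generators of the auxiliary Lie algebra: `e i`, `f i`, and all elements of `H`. -/
inductive Gen (ι H : Type*)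
  | e : ι → Gen ι H
  | f : ι → Gen ι H
  | h : H → Gen ι H

section KacMoodyAlgebra

variable {ι : Type*} [Fintype ι] [DecidableEq ι] {C : Matrix ι ι ℤ}
  {H : Type*} [AddCommGroup H] [Module ℂ H]

/-- The free generators. -/
abbrev fe (H : Type*) {ι : Type*} (i : ι) : FreeLieAlgebra ℂ (Gen ι H) :=
  FreeLieAlgebra.of ℂ (Gen.e i)

/-- The free generators. -/
abbrev ff (H : Type*) {ι : Type*} (i : ι) : FreeLieAlgebra ℂ (Gen ι H) :=
  FreeLieAlgebra.of ℂ (Gen.f i)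

/-- The free generators. -/
abbrev fh (ι : Type*) {H : Type*} (x : H) : FreeLieAlgebra ℂ (Gen ι H) :=
  FreeLieAlgebra.of ℂ (Gen.h x)

/-- The defining relations of the auxiliary Lie algebra (each element listed is set to zero).
The first two families make `H → (auxiliary algebra)` linear. -/
inductive Rel (R : Realization C H) : FreeLieAlgebra ℂ (Gen ι H) → Prop
  | add (x y : H) : Rel R (fh ι (x + y) - fh ι x - fh ι y)
  | smul (c : ℂ) (x : H) : Rel R (fh ι (c • x) - c • fh ι x)
  | hh (x y : H) : Rel R ⁅fh ι x, fh ι y⁆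
  | ef (i : ι) : Rel R (⁅fe H i, ff H i⁆ - fh ι (R.coroot i))
  | ef_ne (i j : ι) (hij : i ≠ j) : Rel R ⁅fe H i, ff H j⁆
  | he (x : H) (i : ι) : Rel R (⁅fh ι x, fe H i⁆ - R.root i x • fe H i)
  | hf (x : H) (i : ι) : Rel R (⁅fh ι x, ff H i⁆ + R.root i x • ff H i)

/-- The auxiliary Lie algebra, presented by generators and relations. -/
def Aux (R : Realization C H) : Type _ :=
  FreeLieAlgebra ℂ (Gen ι H) ⧸ LieSubmodule.lieSpan ℂ (FreeLieAlgebra ℂ (Gen ι H)) {x | Rel R x}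

instance (R : Realization C H) : LieRing (Aux R) :=
  inferInstanceAs (LieRing (FreeLieAlgebra ℂ (Gen ι H) ⧸
    LieSubmodule.lieSpan ℂ (FreeLieAlgebra ℂ (Gen ι H)) {x | Rel R x}))
instance (R : Realization C H) : LieAlgebra ℂ (Aux R) :=
  inferInstanceAs (LieAlgebra ℂ (FreeLieAlgebra ℂ (Gen ι H) ⧸
    LieSubmodule.lieSpan ℂ (FreeLieAlgebra ℂ (Gen ι H)) {x | Rel R x}))

/-- The projection from the free Lie algebra. -/
def auxMk (R : Realization C H) : FreeLieAlgebra ℂ (Gen ι H) →ₗ⁅ℂ⁆ Aux R where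
  toLinearMap := (LieSubmodule.Quotient.mk'
    (LieSubmodule.lieSpan ℂ (FreeLieAlgebra ℂ (Gen ι H)) {x | Rel R x})).toLinearMap
  map_lie' := rfl

/-- The linear map from `H` to the auxiliary Lie algebra. -/
def auxCartanMap (R : Realization C H) : H →ₗ[ℂ] Aux R where
  toFun x := auxMk R (fh ι x)
  map_add' x y := by
    have h : auxMk R (fh ι (x + y) - fh ι x - fh ι y) = 0 :=
      (LieSubmodule.Quotient.mk_eq_zero _).2 (LieSubmodule.subset_lieSpan (Rel.add x y))
    rw [map_sub, map_sub, sub_sub, sub_eq_zero] at h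
    exact h
  map_smul' c x := by
    have h : auxMk R (fh ι (c • x) - c • fh ι x) = 0 :=
      (LieSubmodule.Quotient.mk_eq_zero _).2 (LieSubmodule.subset_lieSpan (Rel.smul c x))
    rw [map_sub, map_smul, sub_eq_zero] at h
    exact h

/-- The largest ideal of the auxiliary Lie algebra meeting the image of `H` trivially. -/
def radical (R : Realization C H) : LieIdeal ℂ (Aux R) :=
  sSup {J | J.toSubmodule ⊓ (auxCartanMap R).range = ⊥}

/-- The Kac-Moody Lie algebra `𝔤`. -/
def KM (R : Realization C H) : Type _ := Aux R ⧸ radical R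

instance (R : Realization C H) : LieRing (KM R) :=
  inferInstanceAs (LieRing (Aux R ⧸ radical R))
instance (R : Realization C H) : LieAlgebra ℂ (KM R) :=
  inferInstanceAs (LieAlgebra ℂ (Aux R ⧸ radical R))

/-- The projection from the auxiliary Lie algebra to the Kac-Moody algebra. -/
def kmMk (R : Realization C H) : Aux R →ₗ⁅ℂ⁆ KM R where
  toLinearMap := (LieSubmodule.Quotient.mk' (radical R)).toLinearMap
  map_lie' := rfl

/-- The Cartan subalgebra `𝔥` of `𝔤`, the image of `H`. -/
def cartan (R : Realization C H) : Submodule ℂ (KM R) :=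
  ((kmMk R : Aux R →ₗ[ℂ] KM R) ∘ₗ auxCartanMap R).range

/-- The derived algebra `𝔤' = [𝔤, 𝔤]`. -/
def derived (R : Realization C H) : LieIdeal ℂ (KM R) :=
  ⁅(⊤ : LieIdeal ℂ (KM R)), (⊤ : LieIdeal ℂ (KM R))⁆

/-- `𝔥' = 𝔥 ∩ 𝔤'`. -/
def cartan' (R : Realization C H) : Submodule ℂ (KM R) :=
  cartan R ⊓ (derived R).toSubmodule

/-- `N⁺`, the subalgebra generated by the positive Chevalley generators. -/
def nPlus (R : Realization C H) : LieSubalgebra ℂ (KM R) :=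
  LieSubalgebra.lieSpan ℂ (KM R) (Set.range fun i : ι => kmMk R (auxMk R (fe H i)))

/-! ### The loop Kac-Moody algebra -/

/-- Laurent polynomials over `ℂ` in `n` commuting variables: the group algebra of `ℤⁿ`. -/
abbrev Laurent (n : ℕ) : Type := AddMonoidAlgebra ℂ (Fin n → ℤ)

/-- For a subspace `W` of `𝔤`, the subspace `W ⊗ A` of `𝔤 ⊗ A` (written as `A ⊗ 𝔤`). -/
def tensorSub (n : ℕ) {R : Realization C H} (W : Submodule ℂ (KM R)) :
    Submodule ℂ (Laurent n ⊗[ℂ] KM R) :=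
  (W.baseChange (Laurent n)).restrictScalars ℂ

/-- For a subspace `W` of `𝔤`, the subspace `W ⊗ 1` of `𝔤 ⊗ A`. -/
def constSub (n : ℕ) {R : Realization C H} (W : Submodule ℂ (KM R)) :
    Submodule ℂ (Laurent n ⊗[ℂ] KM R) :=
  W.map (TensorProduct.mk ℂ (Laurent n) (KM R) 1)

lemma lie_mem_tensorSub (n : ℕ) {R : Realization C H} (x y : Laurent n ⊗[ℂ] KM R) :
    ⁅x, y⁆ ∈ tensorSub n (derived R).toSubmodule := by
  induction x using TensorProduct.induction_on with
  | zero => rw [show ⁅(0 : Laurent n ⊗[ℂ] KM R), y⁆ = 0 from zero_lie y]; exact zero_mem _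
  | add a b ha hb => rw [show ⁅a + b, y⁆ = ⁅a, y⁆ + ⁅b, y⁆ from add_lie a b y]; exact add_mem ha hb
  | tmul p X =>
    induction y using TensorProduct.induction_on with
    | zero => rw [show ⁅p ⊗ₜ[ℂ] X, (0 : Laurent n ⊗[ℂ] KM R)⁆ = 0 from lie_zero (p ⊗ₜ[ℂ] X)]; exact zero_mem _
    | add a b ha hb => rw [show ⁅p ⊗ₜ[ℂ] X, a + b⁆ = ⁅p ⊗ₜ[ℂ] X, a⁆ + ⁅p ⊗ₜ[ℂ] X, b⁆ from lie_add (p ⊗ₜ[ℂ] X) a b]; exact add_mem ha hb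
    | tmul q Y =>
      rw [LieAlgebra.ExtendScalars.bracket_tmul]
      exact Submodule.tmul_mem_baseChange_of_mem _
        (LieSubmodule.lie_mem_lie (LieSubmodule.mem_top X) (LieSubmodule.mem_top Y))

/-- The loop Kac-Moody algebra `𝔤_A = 𝔤' ⊗ A ⊕ 𝔥''`, realized inside `𝔤 ⊗ A` with `𝔥''` identified
with `𝔥'' ⊗ 1` (the sum is direct when `𝔥''` is a complement of `𝔥'` in `𝔥`, as then
`𝔥'' ∩ 𝔤' = 0`).  The bracket of `𝔤 ⊗ A` is `[X ⊗ p, Y ⊗ q] = [X, Y] ⊗ p q`, so that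
`[h, X ⊗ p] = [h, X] ⊗ p` for `h` in `𝔥''`. -/
def gA (n : ℕ) (R : Realization C H) (W : Submodule ℂ (KM R)) :
    LieSubalgebra ℂ (Laurent n ⊗[ℂ] KM R) where
  toSubmodule := tensorSub n (derived R).toSubmodule ⊔ constSub n W
  lie_mem' := fun {x y} _ _ => Submodule.mem_sup_left (lie_mem_tensorSub n x y)

/-- `𝔥_A = 𝔥' ⊗ A ⊕ 𝔥''` as a subspace of `𝔤_A`. -/
def hA (n : ℕ) (R : Realization C H) (W : Submodule ℂ (KM R)) : Submodule ℂ (gA n R W) :=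
  (tensorSub n (cartan' R) ⊔ constSub n W).comap (gA n R W).toSubmodule.subtype

/-- `N⁺ ⊗ A` as a subspace of `𝔤_A`. -/
def nA (n : ℕ) (R : Realization C H) (W : Submodule ℂ (KM R)) : Submodule ℂ (gA n R W) :=
  (tensorSub n (nPlus R).toSubmodule).comap (gA n R W).toSubmodule.subtype

/-- The element `h ⊗ p` of `𝔥_A`, for `h` in `𝔥'` and `p` in `A`. -/
def hTensor {n : ℕ} {R : Realization C H} (W : Submodule ℂ (KM R))
    (h : cartan' R) (p : Laurent n) : hA n R W :=
  ⟨⟨p ⊗ₜ[ℂ] (h : KM R),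
    Submodule.mem_sup_left (Submodule.tmul_mem_baseChange_of_mem p h.2.2)⟩,
    Submodule.mem_sup_left (Submodule.tmul_mem_baseChange_of_mem p h.2)⟩

/-! ### Highest weight modules -/

attribute [local instance 100] LieRing.ofAssociativeRing

variable {n : ℕ} {R : Realization C H} {W : Submodule ℂ (KM R)}

/-- The universal enveloping algebra `U(𝔤_A)`. -/
abbrev UgA (n : ℕ) (R : Realization C H) (W : Submodule ℂ (KM R)) : Type _ :=
  UniversalEnvelopingAlgebra ℂ (gA n R W)

/-- The left ideal of `U(𝔤_A)` generated by `N⁺ ⊗ A` and by all `h - ψ(h) 1` with `h` in `𝔥_A`. -/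
def vermaIdeal (ψ : hA n R W →ₗ[ℂ] ℂ) : Submodule (UgA n R W) (UgA n R W) :=
  Submodule.span (UgA n R W)
    ({u | ∃ x ∈ nA n R W, u = UniversalEnvelopingAlgebra.ι ℂ x} ∪
     {u | ∃ h : hA n R W, u = UniversalEnvelopingAlgebra.ι ℂ (h : gA n R W) -
        algebraMap ℂ (UgA n R W) (ψ h)})

/-- The induced module `M(ψ) = U(𝔤_A) ⊗_{U(𝔟)} ℂ`, where `𝔟 = (N⁺ ⊗ A) ⊕ 𝔥_A` acts on `ℂ` through
`0` on `N⁺ ⊗ A` and through `ψ` on `𝔥_A`.  As the inducing module is cyclic, with annihilator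
generated by `N⁺ ⊗ A` and the `h - ψ(h) 1`, this tensor product is the quotient of `U(𝔤_A)` by the
left ideal generated by these elements. -/
def M (ψ : hA n R W →ₗ[ℂ] ℂ) : Type _ := UgA n R W ⧸ vermaIdeal ψ

instance (ψ : hA n R W →ₗ[ℂ] ℂ) : AddCommGroup (M ψ) :=
  inferInstanceAs (AddCommGroup (UgA n R W ⧸ vermaIdeal ψ))
instance (ψ : hA n R W →ₗ[ℂ] ℂ) : Module (UgA n R W) (M ψ) :=
  inferInstanceAs (Module (UgA n R W) (UgA n R W ⧸ vermaIdeal ψ))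
instance (ψ : hA n R W →ₗ[ℂ] ℂ) : Module ℂ (M ψ) :=
  inferInstanceAs (Module ℂ (UgA n R W ⧸ vermaIdeal ψ))
instance (ψ : hA n R W →ₗ[ℂ] ℂ) : IsScalarTower ℂ (UgA n R W) (M ψ) :=
  inferInstanceAs (IsScalarTower ℂ (UgA n R W) (UgA n R W ⧸ vermaIdeal ψ))

/-- The largest proper submodule of `M(ψ)` (the sum of all proper submodules). -/
def maxSubmodule (ψ : hA n R W →ₗ[ℂ] ℂ) : Submodule (UgA n R W) (M ψ) :=
  sSup {N | N ≠ ⊤}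

/-- The unique irreducible quotient `V(ψ)` of `M(ψ)`. -/
def V (ψ : hA n R W →ₗ[ℂ] ℂ) : Type _ := M ψ ⧸ maxSubmodule ψ

instance (ψ : hA n R W →ₗ[ℂ] ℂ) : AddCommGroup (V ψ) :=
  inferInstanceAs (AddCommGroup (M ψ ⧸ maxSubmodule ψ))
instance (ψ : hA n R W →ₗ[ℂ] ℂ) : Module (UgA n R W) (V ψ) :=
  inferInstanceAs (Module (UgA n R W) (M ψ ⧸ maxSubmodule ψ))
instance (ψ : hA n R W →ₗ[ℂ] ℂ) : Module ℂ (V ψ) :=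
  inferInstanceAs (Module ℂ (M ψ ⧸ maxSubmodule ψ))
instance (ψ : hA n R W →ₗ[ℂ] ℂ) : IsScalarTower ℂ (UgA n R W) (V ψ) :=
  inferInstanceAs (IsScalarTower ℂ (UgA n R W) (M ψ ⧸ maxSubmodule ψ))

/-- `V(ψ)` as a `𝔤_A`-module: `x` acts as its image in `U(𝔤_A)`. -/
instance (ψ : hA n R W →ₗ[ℂ] ℂ) : LieRingModule (gA n R W) (V ψ) where
  bracket x v := UniversalEnvelopingAlgebra.ι ℂ x • v
  add_lie x y v := by
    change UniversalEnvelopingAlgebra.ι ℂ (x + y) • v = _ • v + _ • v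
    rw [map_add, add_smul]
  lie_add x v w := smul_add _ v w
  leibniz_lie x y v := by
    change UniversalEnvelopingAlgebra.ι ℂ x • UniversalEnvelopingAlgebra.ι ℂ y • v =
      UniversalEnvelopingAlgebra.ι ℂ ⁅x, y⁆ • v +
        UniversalEnvelopingAlgebra.ι ℂ y • UniversalEnvelopingAlgebra.ι ℂ x • v
    rw [LieHom.map_lie, LieRing.of_associative_ring_bracket, sub_smul, mul_smul, mul_smul,
      sub_add_cancel]

lemma lie_def (ψ : hA n R W →ₗ[ℂ] ℂ) (x : gA n R W) (v : V ψ) :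
    ⁅x, v⁆ = UniversalEnvelopingAlgebra.ι ℂ x • v := rfl

instance (ψ : hA n R W →ₗ[ℂ] ℂ) : LieModule ℂ (gA n R W) (V ψ) where
  smul_lie c x v := by rw [lie_def, lie_def, map_smul, smul_assoc]
  lie_smul c x v := by
    rw [lie_def, lie_def, ← algebraMap_smul (UgA n R W) c v, ← mul_smul,
      ← Algebra.commutes, mul_smul, algebraMap_smul]

end KacMoodyAlgebra

end LoopKacMoody

end

/-!
Call a module cyclic of highest weight `ψ` if it is generated, under the lowering operators `fᵢ ⊗
p`, by a vector killed by all `eᵢ ⊗ p` on which `𝔥_A` acts through `ψ`. Its weight spaces for a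
principal grading element (on which all simple roots are `1`) show that the highest weight line
is a complement of the span of the images of the `fᵢ ⊗ p`, so all proper submodules lie in that
span, and the module is irreducible if and only if the multiples of the highest weight vector are
the only vectors killed by all `eᵢ ⊗ p`. In particular the only irreducible one of weight `ψ` is
`V(ψ)`.

If `ψ` vanishes on `𝔥' ⊗ I`, then the vectors `(fᵢ ⊗ p) w` with `p ∈ I` span a proper submodule
of `V(ψ)`, which is therefore zero; hence `eᵢ ⊗ p` and `fᵢ ⊗ p` act by zero on `V(ψ)` for `p ∈
I`. Since `I₁ + I₂ = A`, each generator acts on `V(ψ₁)` like one that acts by zero on `V(ψ₂)`,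
and vice versa. So `V(ψ₁) ⊗ V(ψ₂)` is again cyclic, and a vector in it killed by all `eᵢ ⊗ p` is
killed by them in each factor separately, so that it is a multiple of `v₁ ⊗ v₂`.

That `M(ψ) ≠ 0` is shown without the Poincaré-Birkhoff-Witt theorem. Words in the `fᵢ ⊗ p` carry
operators which obey the commutation relations prescribed for the generators of `𝔤_A`, but
perhaps not all relations of `𝔤_A`. In the Lie algebra generated by the pairs of a generator of
`𝔤_A` and its operator, an element `(0, φ)` splits as lower + diagonal + upper with zero first
components, so `φ w` has no empty-word coefficient, for every `w`; dividing out the images of all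
such `φ` gives a `𝔤_A`-module in which the empty word is a nonzero highest weight vector.
-/

noncomputable section

namespace LoopKacMoody

attribute [local instance 100] LieRing.ofAssociativeRing

section LieSpan

variable {𝕜 L : Type*} [CommRing 𝕜] [LieRing L] [LieAlgebra 𝕜 L]

lemma lie_mem_of_mem_lieSpan {M : Type*} [AddCommGroup M] [Module 𝕜 M] [LieRingModule L M]
    [LieModule 𝕜 L M] {s : Set L} {S S' : Submodule 𝕜 M} (hle : S' ≤ S)
    (hs : ∀ g ∈ s, ∀ m ∈ S, ⁅g, m⁆ ∈ S') {a : L} (ha : a ∈ LieSubalgebra.lieSpan 𝕜 L s) :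
    ∀ m ∈ S, ⁅a, m⁆ ∈ S' := by
  induction ha using LieSubalgebra.lieSpan_induction with
  | mem a ha => exact hs a ha
  | zero => simp
  | smul c a _ ih => exact fun m hm => smul_lie c a m ▸ S'.smul_mem c (ih m hm)
  | add a b _ _ iha ihb => exact fun m hm => add_lie a b m ▸ add_mem (iha m hm) (ihb m hm)
  | lie a b _ _ iha ihb =>
    exact fun m hm => lie_lie a b m ▸
      sub_mem (iha _ (hle (ihb m hm))) (ihb _ (hle (iha m hm)))

lemma lieSpan_le_of_forall_lie_mem {s : Set L} {S : Submodule 𝕜 L} (hsS : s ⊆ S)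
    (hs : ∀ g ∈ s, ∀ a ∈ S, ⁅g, a⁆ ∈ S) : (LieSubalgebra.lieSpan 𝕜 L s).toSubmodule ≤ S := by
  intro a ha
  induction (ha : a ∈ LieSubalgebra.lieSpan 𝕜 L s) using LieSubalgebra.lieSpan_induction with
  | mem a ha => exact hsS ha
  | zero => exact zero_mem S
  | smul c a _ ih => exact S.smul_mem c ih
  | add a b _ _ iha ihb => exact add_mem iha ihb
  | lie a b ha _ _ ihb => exact lie_mem_of_mem_lieSpan le_rfl hs ha b ihb

lemma lie_mem_lieSpan_of_forall {s : Set L} {g : L}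
    (hs : ∀ a ∈ s, ⁅g, a⁆ ∈ LieSubalgebra.lieSpan 𝕜 L s) {a : L}
    (ha : a ∈ LieSubalgebra.lieSpan 𝕜 L s) : ⁅g, a⁆ ∈ LieSubalgebra.lieSpan 𝕜 L s := by
  induction ha using LieSubalgebra.lieSpan_induction with
  | mem a ha => exact hs a ha
  | zero => simp
  | smul c a _ ih => rw [lie_smul]; exact SMulMemClass.smul_mem c ih
  | add a b _ _ iha ihb => rw [lie_add]; exact add_mem iha ihb
  | lie a b ha hb iha ihb =>
    rw [leibniz_lie]
    exact add_mem (LieSubalgebra.lie_mem _ iha hb) (LieSubalgebra.lie_mem _ ha ihb)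

lemma lie_mem_lieSpan_sup {s : Set L} {T : Submodule 𝕜 L} {g : L}
    (hT : ∀ b ∈ T, ∀ a ∈ s, ⁅b, a⁆ ∈ LieSubalgebra.lieSpan 𝕜 L s)
    (hg : ∀ a ∈ s, ⁅g, a⁆ ∈ T) {a : L} (ha : a ∈ LieSubalgebra.lieSpan 𝕜 L s) :
    ⁅g, a⁆ ∈ (LieSubalgebra.lieSpan 𝕜 L s).toSubmodule ⊔ T := by
  set N := LieSubalgebra.lieSpan 𝕜 L s
  have hsN {b : L} (hb : b ∈ s) : b ∈ N := LieSubalgebra.subset_lieSpan hb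
  suffices h : N.toSubmodule ≤ N.toSubmodule ⊓ (N.toSubmodule ⊔ T).comap (LieAlgebra.ad 𝕜 L g) from
    (h ha).2
  refine lieSpan_le_of_forall_lie_mem
    (fun b hb => ⟨hsN hb, Submodule.mem_sup_right (hg b hb)⟩) ?_
  rintro b hb a ⟨ha, hga⟩
  refine ⟨N.lie_mem (hsN hb) ha, Submodule.mem_sup_left ?_⟩
  obtain ⟨a₁, ha₁, a₂, ha₂, hsum⟩ := Submodule.mem_sup.1 hga
  rw [LieAlgebra.ad_apply, leibniz_lie, ← LieAlgebra.ad_apply 𝕜 L g a, ← hsum, lie_add,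
    ← lie_skew b a₂]
  exact add_mem (lie_mem_lieSpan_of_forall (hT _ (hg b hb)) ha)
    (add_mem (N.lie_mem (hsN hb) ha₁) (neg_mem (hT a₂ ha₂ b hb)))

lemma lieSpan_le_triangular {s s' : Set L} {T : Submodule 𝕜 L}
    (hT : ∀ b ∈ T, ∀ c ∈ T, ⁅b, c⁆ ∈ T)
    (hs : ∀ b ∈ T, ∀ a ∈ s, ⁅b, a⁆ ∈ LieSubalgebra.lieSpan 𝕜 L s)
    (hs' : ∀ b ∈ T, ∀ a ∈ s', ⁅b, a⁆ ∈ LieSubalgebra.lieSpan 𝕜 L s')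
    (hss' : ∀ a ∈ s, ∀ a' ∈ s', ⁅a, a'⁆ ∈ T) :
    (LieSubalgebra.lieSpan 𝕜 L (s ∪ T ∪ s')).toSubmodule ≤
      (LieSubalgebra.lieSpan 𝕜 L s).toSubmodule ⊔ T ⊔
        (LieSubalgebra.lieSpan 𝕜 L s').toSubmodule := by
  set N := LieSubalgebra.lieSpan 𝕜 L s
  set N' := LieSubalgebra.lieSpan 𝕜 L s'
  set S := N.toSubmodule ⊔ T ⊔ N'.toSubmodule
  have hNT : N.toSubmodule ⊔ T ≤ S := le_sup_left
  have hN'T : N'.toSubmodule ⊔ T ≤ S := sup_le le_sup_right (le_sup_right.trans hNT)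
  have hN : N.toSubmodule ≤ S := le_sup_left.trans hNT
  have hN' : N'.toSubmodule ≤ S := le_sup_right
  have hsN {a : L} (ha : a ∈ s) : a ∈ N := LieSubalgebra.subset_lieSpan ha
  have hsN' {a : L} (ha : a ∈ s') : a ∈ N' := LieSubalgebra.subset_lieSpan ha
  have lie_mem_of_parts {g : L} (h : ∀ b ∈ N, ⁅g, b⁆ ∈ S) (hd : ∀ b ∈ T, ⁅g, b⁆ ∈ S)
      (h' : ∀ b ∈ N', ⁅g, b⁆ ∈ S) : ∀ b ∈ S, ⁅g, b⁆ ∈ S :=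
    (sup_le (sup_le h hd) h' : S ≤ S.comap (LieAlgebra.ad 𝕜 L g))
  refine lieSpan_le_of_forall_lie_mem ?_ ?_
  · rintro a ((ha | ha) | ha)
    exacts [hN (hsN ha), hNT (Submodule.mem_sup_right ha), hN' (hsN' ha)]
  · rintro g ((hg | hg) | hg)
    · refine lie_mem_of_parts (fun b hb => hN (N.lie_mem (hsN hg) hb))
        (fun b hb => hN ?_) fun b hb => hN'T (lie_mem_lieSpan_sup hs' (hss' g hg) hb)
      exact lie_skew g b ▸ neg_mem (hs b hb g hg)
    · exact lie_mem_of_parts (fun b hb => hN (lie_mem_lieSpan_of_forall (hs g hg) hb))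
        (fun b hb => hNT (Submodule.mem_sup_right (hT g hg b hb)))
        fun b hb => hN' (lie_mem_lieSpan_of_forall (hs' g hg) hb)
    · refine lie_mem_of_parts (fun b hb => hNT (lie_mem_lieSpan_sup hs (fun a ha => ?_) hb))
        (fun b hb => hN' ?_) fun b hb => hN' (N'.lie_mem (hsN' hg) hb)
      · exact lie_skew g a ▸ neg_mem (hss' a ha g hg)
      · exact lie_skew g b ▸ neg_mem (hs' b hb g hg)

end LieSpan

section Eigenspaces

variable {𝕜 : Type*} [Field 𝕜]

/-- The sum of the eigenspaces of `T` for the eigenvalues other than `c`. -/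
def offEigenspace {V : Type*} [AddCommGroup V] [Module 𝕜 V] (T : Module.End 𝕜 V) (c : 𝕜) :
    Submodule 𝕜 V :=
  ⨆ μ ≠ c, T.eigenspace μ

lemma disjoint_eigenspace_offEigenspace {V : Type*} [AddCommGroup V] [Module 𝕜 V]
    (T : Module.End 𝕜 V) (c : 𝕜) : Disjoint (T.eigenspace c) (offEigenspace T c) :=
  T.eigenspaces_iSupIndep c

lemma iSup_eigenspace_le_offEigenspace {V κ : Type*} [AddCommGroup V] [Module 𝕜 V]
    (T : Module.End 𝕜 V) {c : 𝕜} {μ : κ → 𝕜} (hμ : ∀ k, μ k ≠ c) :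
    ⨆ k, T.eigenspace (μ k) ≤ offEigenspace T c :=
  iSup_le fun k => le_iSup₂_of_le (μ k) (hμ k) le_rfl

variable {L : Type*} [LieRing L] [LieAlgebra 𝕜 L]

lemma lieSpan_le_offEigenspace_ad [CharZero 𝕜] {s : Set L} {g : L} {k : 𝕜} (hk : k ≠ 0)
    (hs : ∀ a ∈ s, ⁅g, a⁆ = k • a) :
    (LieSubalgebra.lieSpan 𝕜 L s).toSubmodule ≤ offEigenspace (LieAlgebra.ad 𝕜 L g) 0 := by
  set S := ⨆ m : ℕ, (LieAlgebra.ad 𝕜 L g).eigenspace ((m + 1) * k)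
  have hS : S ≤ offEigenspace (LieAlgebra.ad 𝕜 L g) 0 :=
    iSup_eigenspace_le_offEigenspace _ fun m => mul_ne_zero (Nat.cast_add_one_ne_zero m) hk
  refine (lieSpan_le_of_forall_lie_mem (fun a ha => ?_) fun a ha b hb => ?_).trans hS
  · exact Submodule.mem_iSup_of_mem 0 (Module.End.mem_eigenspace_iff.2 (by simp [hs a ha]))
  · refine Submodule.iSup_induction _ (motive := fun b => ⁅a, b⁆ ∈ S) hb (fun m b hb => ?_)
      (by simp) fun b c hb hc => by rw [lie_add]; exact add_mem hb hc
    refine Submodule.mem_iSup_of_mem (m + 1) (Module.End.mem_eigenspace_iff.2 ?_)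
    rw [Module.End.mem_eigenspace_iff, LieAlgebra.ad_apply] at hb
    rw [LieAlgebra.ad_apply, leibniz_lie, hs a ha, hb, smul_lie, lie_smul, ← add_smul]
    push_cast
    ring_nf

end Eigenspaces

section LieHom

variable {𝕜 L L' L'' : Type*} [CommRing 𝕜] [LieRing L] [LieAlgebra 𝕜 L] [LieRing L']
  [LieAlgebra 𝕜 L'] [LieRing L''] [LieAlgebra 𝕜 L'']

lemma exists_lieHom_comp_eq {f : L →ₗ⁅𝕜⁆ L'} (hf : Function.Surjective f) {g : L →ₗ⁅𝕜⁆ L''}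
    (hker : ∀ a, f a = 0 → g a = 0) : ∃ ρ : L' →ₗ⁅𝕜⁆ L'', ∀ a, ρ (f a) = g a := by
  have hfg {a b : L} (h : f a = f b) : g a = g b := by
    rw [← sub_eq_zero, ← map_sub, hker _ (by rw [map_sub, h, sub_self])]
  let σ := Function.surjInv hf
  have hσ (y : L') : f (σ y) = y := Function.surjInv_eq hf y
  refine ⟨{ toFun := fun y => g (σ y), map_add' := ?_, map_smul' := ?_, map_lie' := ?_ },
    fun a => hfg (hσ (f a))⟩
  · exact fun x y => (hfg (by simp [hσ])).trans (map_add g (σ x) (σ y))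
  · exact fun c x => (hfg (by simp [hσ])).trans (map_smul g c (σ x))
  · exact fun {x y} => (hfg (by simp [hσ])).trans (LieHom.map_lie g (σ x) (σ y))

end LieHom

/-- Structure constants of a triangular presentation with raising generators `e x`, lowering
generators `f x` (`x : X`) and commuting diagonal generators `h z` (`z : Z`): the relations are
`⁅h z, e x⁆ = e (act z x)`, `⁅h z, f x⁆ = -f (act z x)` and `⁅e x, f y⁆ = h (pairing x y)`, and
`h grading` induces the principal grading. -/
structure TriangularData (X Z : Type*) where
  act : Z → X → X
  pairing : X → X → Z
  grading : Z
  act_comm : ∀ z z' x, act z (act z' x) = act z' (act z x)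
  pairing_act : ∀ z x y, pairing (act z x) y = pairing x (act z y)
  act_grading : ∀ x, act grading x = x

variable {X Z : Type*}

/-- Elements of the Lie algebra `L` satisfying the relations prescribed by `D`. -/
structure TriangularData.Generators (D : TriangularData X Z) (L : Type*) [LieRing L] where
  e : X → L
  f : X → L
  h : Z → L
  lie_h_h : ∀ z z', ⁅h z, h z'⁆ = 0
  lie_h_e : ∀ z x, ⁅h z, e x⁆ = e (D.act z x)
  lie_h_f : ∀ z x, ⁅h z, f x⁆ = -f (D.act z x)
  lie_e_f : ∀ x y, ⁅e x, f y⁆ = h (D.pairing x y)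

namespace TriangularData.Generators

variable {D : TriangularData X Z}

/-- The componentwise generators of a product. -/
@[simps]
def prod {L L' : Type*} [LieRing L] [LieRing L'] (t : D.Generators L) (t' : D.Generators L') :
    D.Generators (L × L') where
  e x := (t.e x, t'.e x)
  f x := (t.f x, t'.f x)
  h z := (t.h z, t'.h z)
  lie_h_h z z' := Prod.ext (t.lie_h_h z z') (t'.lie_h_h z z')
  lie_h_e z x := Prod.ext (t.lie_h_e z x) (t'.lie_h_e z x)
  lie_h_f z x := Prod.ext (t.lie_h_f z x) (t'.lie_h_f z x)
  lie_e_f x y := Prod.ext (t.lie_e_f x y) (t'.lie_e_f x y)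

variable {𝕜 L : Type*} [Field 𝕜] [LieRing L] [LieAlgebra 𝕜 L] (t : D.Generators L)

variable (𝕜) in
/-- The Lie subalgebra generated by all the generators. -/
def span : LieSubalgebra 𝕜 L :=
  LieSubalgebra.lieSpan 𝕜 L (Set.range t.e ∪ Set.range t.f ∪ Set.range t.h)

variable (𝕜) in
/-- The subalgebra generated by the raising generators. -/
def upper : LieSubalgebra 𝕜 L :=
  LieSubalgebra.lieSpan 𝕜 L (Set.range t.e)

variable (𝕜) in
/-- The subalgebra generated by the lowering generators. -/
def lower : LieSubalgebra 𝕜 L :=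
  LieSubalgebra.lieSpan 𝕜 L (Set.range t.f)

variable (𝕜) in
/-- The span of the diagonal generators. -/
def diagonal : Submodule 𝕜 L :=
  Submodule.span 𝕜 (Set.range t.h)

lemma e_mem_span (x : X) : t.e x ∈ t.span 𝕜 :=
  LieSubalgebra.subset_lieSpan (.inl (.inl ⟨x, rfl⟩))

lemma f_mem_span (x : X) : t.f x ∈ t.span 𝕜 :=
  LieSubalgebra.subset_lieSpan (.inl (.inr ⟨x, rfl⟩))

lemma h_mem_span (z : Z) : t.h z ∈ t.span 𝕜 :=
  LieSubalgebra.subset_lieSpan (.inr ⟨z, rfl⟩)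

lemma span_le {K : LieSubalgebra 𝕜 L} (he : ∀ x, t.e x ∈ K) (hf : ∀ x, t.f x ∈ K)
    (hh : ∀ z, t.h z ∈ K) : t.span 𝕜 ≤ K := by
  refine LieSubalgebra.lieSpan_le.2 ?_
  rintro _ ((⟨x, rfl⟩ | ⟨x, rfl⟩) | ⟨z, rfl⟩)
  exacts [he x, hf x, hh z]

lemma lie_mem_of_mem_diagonal {S : Submodule 𝕜 L} {a : L} (hS : ∀ z, ⁅t.h z, a⁆ ∈ S) {b : L}
    (hb : b ∈ t.diagonal 𝕜) : ⁅b, a⁆ ∈ S := by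
  refine (Submodule.span_le.2 ?_ : t.diagonal 𝕜 ≤ S.comap ((LieModule.toEnd 𝕜 L L).flip a)) hb
  rintro _ ⟨z, rfl⟩
  exact hS z

lemma lie_h_eq_zero_of_mem_diagonal (z : Z) {b : L} (hb : b ∈ t.diagonal 𝕜) : ⁅t.h z, b⁆ = 0 := by
  refine (Submodule.span_le.2 ?_ : t.diagonal 𝕜 ≤ (LieAlgebra.ad 𝕜 L (t.h z)).ker) hb
  rintro _ ⟨z', rfl⟩
  exact t.lie_h_h z z'

lemma span_le_triangular :
    (t.span 𝕜).toSubmodule ≤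
      (t.lower 𝕜).toSubmodule ⊔ t.diagonal 𝕜 ⊔ (t.upper 𝕜).toSubmodule := by
  refine le_trans (LieSubalgebra.lieSpan_mono ?_) (lieSpan_le_triangular ?_ ?_ ?_ ?_)
  · rintro _ ((⟨x, rfl⟩ | ⟨x, rfl⟩) | ⟨z, rfl⟩)
    exacts [.inr ⟨x, rfl⟩, .inl (.inl ⟨x, rfl⟩), .inl (.inr (Submodule.subset_span ⟨z, rfl⟩))]
  · refine fun b hb c hc => t.lie_mem_of_mem_diagonal (fun z => ?_) hb
    exact (t.lie_h_eq_zero_of_mem_diagonal z hc).symm ▸ zero_mem _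
  · rintro b hb _ ⟨x, rfl⟩
    refine t.lie_mem_of_mem_diagonal (S := (t.lower 𝕜).toSubmodule) (fun z => ?_) hb
    exact t.lie_h_f z x ▸ neg_mem (LieSubalgebra.subset_lieSpan ⟨_, rfl⟩)
  · rintro b hb _ ⟨x, rfl⟩
    refine t.lie_mem_of_mem_diagonal (S := (t.upper 𝕜).toSubmodule) (fun z => ?_) hb
    exact t.lie_h_e z x ▸ LieSubalgebra.subset_lieSpan ⟨_, rfl⟩
  · rintro _ ⟨x, rfl⟩ _ ⟨y, rfl⟩
    rw [← lie_skew, t.lie_e_f]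
    exact neg_mem (Submodule.subset_span ⟨_, rfl⟩)

lemma eq_zero_of_mem_diagonal_of_add_eq_zero [CharZero 𝕜] {a b c : L} (ha : a ∈ t.lower 𝕜)
    (hb : b ∈ t.diagonal 𝕜) (hc : c ∈ t.upper 𝕜) (h : a + b + c = 0) : b = 0 := by
  have ha' : a ∈ offEigenspace (LieAlgebra.ad 𝕜 L (t.h D.grading)) 0 := by
    refine lieSpan_le_offEigenspace_ad (neg_ne_zero.2 one_ne_zero) ?_ ha
    rintro _ ⟨x, rfl⟩
    rw [t.lie_h_f, D.act_grading, neg_one_smul]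
  have hc' : c ∈ offEigenspace (LieAlgebra.ad 𝕜 L (t.h D.grading)) 0 := by
    refine lieSpan_le_offEigenspace_ad one_ne_zero ?_ hc
    rintro _ ⟨x, rfl⟩
    rw [t.lie_h_e, D.act_grading, one_smul]
  have hb₀ : b ∈ (LieAlgebra.ad 𝕜 L (t.h D.grading)).eigenspace 0 := by
    rw [Module.End.mem_eigenspace_iff, zero_smul]
    exact t.lie_h_eq_zero_of_mem_diagonal _ hb
  refine Submodule.disjoint_def.1 (disjoint_eigenspace_offEigenspace _ _) b hb₀ ?_
  rw [eq_neg_of_add_eq_zero_left (show b + (a + c) = 0 by rw [← h]; abel)]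
  exact neg_mem (add_mem ha' hc')

end TriangularData.Generators

section Words

variable {𝕜 X Z : Type*} [Field 𝕜]

/-- Left multiplication by the letter `x` on the space of linear combinations of words in `X`. -/
def consWord (x : X) : Module.End 𝕜 (List X →₀ 𝕜) := Finsupp.lmapDomain 𝕜 𝕜 (List.cons x)

/-- The coefficient of the empty word. -/
def emptyCoeff : (List X →₀ 𝕜) →ₗ[𝕜] 𝕜 := Finsupp.lapply []

variable (𝕜 X) in
/-- The empty word. -/
def emptyWord : List X →₀ 𝕜 := Finsupp.single [] 1

lemma emptyCoeff_emptyWord : emptyCoeff (emptyWord 𝕜 X) = 1 := by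
  simp [emptyCoeff, emptyWord]

lemma emptyCoeff_consWord (x : X) (w : List X →₀ 𝕜) : emptyCoeff (consWord x w) = 0 :=
  Finsupp.mapDomain_of_notMem_range w [] (by simp)

lemma eq_top_of_consWord_mem {S : Submodule 𝕜 (List X →₀ 𝕜)} (h₀ : emptyWord 𝕜 X ∈ S)
    (hS : ∀ x, ∀ w ∈ S, consWord x w ∈ S) : S = ⊤ := by
  have single_mem (l : List X) : Finsupp.single l 1 ∈ S := by
    induction l with
    | nil => exact h₀
    | cons x l ih =>
      have := hS x _ ih
      rwa [consWord, Finsupp.lmapDomain_apply, Finsupp.mapDomain_single] at this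
  refine eq_top_iff.2 fun w _ => ?_
  rw [← Finsupp.sum_single w]
  refine Submodule.sum_mem _ fun l _ => ?_
  simpa using S.smul_mem (w l) (single_mem l)

lemma word_linearMap_ext {M : Type*} [AddCommGroup M] [Module 𝕜 M]
    {φ φ' : (List X →₀ 𝕜) →ₗ[𝕜] M}
    (h₀ : φ (emptyWord 𝕜 X) = φ' (emptyWord 𝕜 X))
    (h : ∀ x w, φ w = φ' w → φ (consWord x w) = φ' (consWord x w)) : φ = φ' :=
  LinearMap.eqLocus_eq_top.1 (eq_top_of_consWord_mem h₀ h)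

/-- The operator `φ` with `φ 1 = a` on the empty word and `φ (x w) = x φ w + c x w`. -/
def wordOperator (a : List X →₀ 𝕜) (c : X → Module.End 𝕜 (List X →₀ 𝕜)) :
    Module.End 𝕜 (List X →₀ 𝕜) :=
  Finsupp.linearCombination 𝕜 fun l : List X =>
    l.rec a fun x l b => consWord x b + c x (Finsupp.single l 1)

lemma wordOperator_emptyWord (a : List X →₀ 𝕜) (c : X → Module.End 𝕜 (List X →₀ 𝕜)) :
    wordOperator a c (emptyWord 𝕜 X) = a := by
  simp [wordOperator, emptyWord]

lemma wordOperator_consWord (a : List X →₀ 𝕜) (c : X → Module.End 𝕜 (List X →₀ 𝕜)) (x : X)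
    (w : List X →₀ 𝕜) :
    wordOperator a c (consWord x w) = consWord x (wordOperator a c w) + c x w := by
  induction w using Finsupp.induction_linear with
  | zero => simp
  | add u w hu hw => simp only [map_add, hu, hw]; abel
  | single l b =>
    rw [← mul_one b, ← smul_eq_mul, ← Finsupp.smul_single]
    simp only [map_smul, ← smul_add]
    congr 1
    simp [wordOperator, consWord]

variable (D : TriangularData X Z) (ψ : Z → 𝕜)

/-- The diagonal operator of index `z` on words, acting on the empty word by `ψ z`. -/
def wordDiagonal (z : Z) : Module.End 𝕜 (List X →₀ 𝕜) :=
  wordOperator (ψ z • emptyWord 𝕜 X) fun x => -consWord (𝕜 := 𝕜) (D.act z x)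

/-- The raising operator of index `x` on words, killing the empty word. -/
def wordRaise (x : X) : Module.End 𝕜 (List X →₀ 𝕜) :=
  wordOperator 0 fun y => wordDiagonal D ψ (D.pairing x y)

lemma wordDiagonal_emptyWord (z : Z) :
    wordDiagonal D ψ z (emptyWord 𝕜 X) = ψ z • emptyWord 𝕜 X :=
  wordOperator_emptyWord _ _

lemma wordDiagonal_consWord (z : Z) (x : X) (w : List X →₀ 𝕜) :
    wordDiagonal D ψ z (consWord x w) =
      consWord x (wordDiagonal D ψ z w) - consWord (D.act z x) w :=
  (wordOperator_consWord _ _ _ _).trans (sub_eq_add_neg _ _).symm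

lemma wordRaise_emptyWord (x : X) : wordRaise D ψ x (emptyWord 𝕜 X) = 0 :=
  wordOperator_emptyWord _ _

lemma wordRaise_consWord (x y : X) (w : List X →₀ 𝕜) :
    wordRaise D ψ x (consWord y w) =
      consWord y (wordRaise D ψ x w) + wordDiagonal D ψ (D.pairing x y) w :=
  wordOperator_consWord _ _ _ _

lemma wordDiagonal_commute (z z' : Z) :
    wordDiagonal D ψ z * wordDiagonal D ψ z' = wordDiagonal D ψ z' * wordDiagonal D ψ z := by
  refine word_linearMap_ext ?_ fun x w hw => ?_
  · simp only [Module.End.mul_apply, wordDiagonal_emptyWord, map_smul, smul_comm (ψ z)]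
  · simp only [Module.End.mul_apply, wordDiagonal_consWord, map_sub] at hw ⊢
    rw [hw, D.act_comm z z']
    abel

lemma wordDiagonal_mul_wordRaise (z : Z) (x : X) :
    wordDiagonal D ψ z * wordRaise D ψ x =
      wordRaise D ψ (D.act z x) + wordRaise D ψ x * wordDiagonal D ψ z := by
  refine word_linearMap_ext ?_ fun y w hw => ?_
  · simp only [Module.End.mul_apply, LinearMap.add_apply, wordDiagonal_emptyWord,
      wordRaise_emptyWord, map_smul, map_zero, smul_zero, add_zero]
  · have hcomm := LinearMap.congr_fun (wordDiagonal_commute D ψ z (D.pairing x y)) w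
    simp only [Module.End.mul_apply, LinearMap.add_apply, wordDiagonal_consWord,
      wordRaise_consWord, map_add, map_sub] at hw hcomm ⊢
    rw [hw, hcomm, D.pairing_act, map_add]
    abel

/-- The generators acting on words as on the Verma module of highest weight `ψ` for the Lie algebra
presented by `D`, whose underlying space is the free algebra on the lowering generators. -/
@[simps]
def wordGenerators : D.Generators (Module.End 𝕜 (List X →₀ 𝕜)) where
  e := wordRaise D ψ
  f := consWord
  h := wordDiagonal D ψ
  lie_h_h z z' := sub_eq_zero.2 (wordDiagonal_commute D ψ z z')
  lie_h_e z x := sub_eq_iff_eq_add.2 (wordDiagonal_mul_wordRaise D ψ z x)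
  lie_h_f z x := by
    refine LinearMap.ext fun w => ?_
    simp [LieRing.of_associative_ring_bracket, wordDiagonal_consWord]
  lie_e_f x y := by
    refine LinearMap.ext fun w => ?_
    simp [LieRing.of_associative_ring_bracket, wordRaise_consWord]

end Words

namespace TriangularData.Generators

variable {X Z 𝕜 L L' : Type*} {D : TriangularData X Z} [Field 𝕜] [LieRing L] [LieAlgebra 𝕜 L]
  [LieRing L'] [LieAlgebra 𝕜 L'] (t : D.Generators L) (t' : D.Generators L')

lemma fst_mem_lower {a : L × L'} (ha : a ∈ (t.prod t').lower 𝕜) : a.1 ∈ t.lower 𝕜 := by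
  refine (LieSubalgebra.lieSpan_le.2 ?_ :
    (t.prod t').lower 𝕜 ≤ (t.lower 𝕜).comap (LieHom.fst 𝕜 L L')) ha
  rintro _ ⟨x, rfl⟩
  exact LieSubalgebra.subset_lieSpan ⟨x, rfl⟩

lemma fst_mem_upper {a : L × L'} (ha : a ∈ (t.prod t').upper 𝕜) : a.1 ∈ t.upper 𝕜 := by
  refine (LieSubalgebra.lieSpan_le.2 ?_ :
    (t.prod t').upper 𝕜 ≤ (t.upper 𝕜).comap (LieHom.fst 𝕜 L L')) ha
  rintro _ ⟨x, rfl⟩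
  exact LieSubalgebra.subset_lieSpan ⟨x, rfl⟩

lemma snd_mem_lower {a : L × L'} (ha : a ∈ (t.prod t').lower 𝕜) : a.2 ∈ t'.lower 𝕜 := by
  refine (LieSubalgebra.lieSpan_le.2 ?_ :
    (t.prod t').lower 𝕜 ≤ (t'.lower 𝕜).comap (LieHom.snd 𝕜 L L')) ha
  rintro _ ⟨x, rfl⟩
  exact LieSubalgebra.subset_lieSpan ⟨x, rfl⟩

lemma snd_mem_upper {a : L × L'} (ha : a ∈ (t.prod t').upper 𝕜) : a.2 ∈ t'.upper 𝕜 := by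
  refine (LieSubalgebra.lieSpan_le.2 ?_ :
    (t.prod t').upper 𝕜 ≤ (t'.upper 𝕜).comap (LieHom.snd 𝕜 L L')) ha
  rintro _ ⟨x, rfl⟩
  exact LieSubalgebra.subset_lieSpan ⟨x, rfl⟩

lemma fst_mem_diagonal {a : L × L'} (ha : a ∈ (t.prod t').diagonal 𝕜) : a.1 ∈ t.diagonal 𝕜 := by
  refine (Submodule.span_le.2 ?_ :
    (t.prod t').diagonal 𝕜 ≤ (t.diagonal 𝕜).comap (LinearMap.fst 𝕜 L L')) ha
  rintro _ ⟨z, rfl⟩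
  exact Submodule.subset_span ⟨z, rfl⟩

lemma map_fst_span_prod : ((t.prod t').span 𝕜).map (LieHom.fst 𝕜 L L') = t.span 𝕜 := by
  simp only [span, LieSubalgebra.map_lieSpan, Set.image_union, ← Set.range_comp]
  rfl

lemma exists_diagonal_of_mem_span_prod [CharZero 𝕜] {φ : L'}
    (hφ : (0, φ) ∈ (t.prod t').span 𝕜) :
    ∃ a ∈ t'.lower 𝕜, ∃ b, (0, b) ∈ (t.prod t').diagonal 𝕜 ∧ ∃ c ∈ t'.upper 𝕜, a + b + c = φ := by
  obtain ⟨_, h, c, hc, hφ⟩ := Submodule.mem_sup.1 ((t.prod t').span_le_triangular hφ)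
  obtain ⟨a, ha, b, hb, rfl⟩ := Submodule.mem_sup.1 h
  have hb₀ : b.1 = 0 :=
    t.eq_zero_of_mem_diagonal_of_add_eq_zero (t.fst_mem_lower t' ha) (t.fst_mem_diagonal t' hb)
      (t.fst_mem_upper t' hc) (Prod.ext_iff.1 hφ).1
  exact ⟨a.2, t.snd_mem_lower t' ha, b.2, hb₀ ▸ hb, c.2, t.snd_mem_upper t' hc,
    (Prod.ext_iff.1 hφ).2⟩

end TriangularData.Generators

section Quotient

variable {𝕜 G L M : Type*} [CommRing 𝕜] [LieRing G] [LieAlgebra 𝕜 G] [LieRing L] [LieAlgebra 𝕜 L]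
  [AddCommGroup M] [Module 𝕜 M] [LieRingModule G M] [LieModule 𝕜 G M]

lemma exists_lieHom_end_quotient {f : G →ₗ⁅𝕜⁆ L} (hf : Function.Surjective f) :
    ∃ ρ : L →ₗ⁅𝕜⁆ Module.End 𝕜 (M ⧸ ⁅f.ker, (⊤ : LieSubmodule 𝕜 G M)⁆), ∀ g (m : M),
      ρ (f g) (LieSubmodule.Quotient.mk m) = LieSubmodule.Quotient.mk ⁅g, m⁆ := by
  obtain ⟨ρ, hρ⟩ := exists_lieHom_comp_eq hf
    (g := LieModule.toEnd 𝕜 G (M ⧸ ⁅f.ker, (⊤ : LieSubmodule 𝕜 G M)⁆)) fun g hg => by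
      refine LinearMap.ext fun q => ?_
      obtain ⟨m, rfl⟩ := LieSubmodule.Quotient.surjective_mk' _ q
      exact (LieSubmodule.Quotient.mk_eq_zero _).2 (LieSubmodule.lie_mem_lie hg trivial)
  exact ⟨ρ, fun g m => by rw [hρ]; rfl⟩

lemma linearMap_eq_zero_of_mem_ker_lie {f : G →ₗ⁅𝕜⁆ L} {k : M →ₗ[𝕜] 𝕜}
    (hk : ∀ g, f g = 0 → ∀ m : M, k ⁅g, m⁆ = 0) {m : M}
    (hm : m ∈ ⁅f.ker, (⊤ : LieSubmodule 𝕜 G M)⁆) : k m = 0 := by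
  rw [← LieSubmodule.mem_toSubmodule, LieSubmodule.lieIdeal_oper_eq_linear_span'] at hm
  refine (Submodule.span_le.2 ?_ : _ ≤ LinearMap.ker k) hm
  rintro _ ⟨g, hg, m, -, rfl⟩
  exact hk g hg m

end Quotient

section Existence

universe u v

variable {X : Type u} {𝕜 : Type v} {Z L : Type*} {D : TriangularData X Z} [Field 𝕜] [LieRing L]
  [LieAlgebra 𝕜 L]

lemma emptyCoeff_eq_zero_of_mem_lower (ψ : Z → 𝕜) {φ : Module.End 𝕜 (List X →₀ 𝕜)}
    (hφ : φ ∈ (wordGenerators D ψ).lower 𝕜) (w : List X →₀ 𝕜) : emptyCoeff (φ w) = 0 := by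
  refine lie_mem_of_mem_lieSpan (S := ⊤) (S' := LinearMap.ker emptyCoeff) le_top ?_ hφ w trivial
  rintro _ ⟨x, rfl⟩ w -
  exact emptyCoeff_consWord x w

lemma apply_emptyWord_eq_zero_of_mem_upper (ψ : Z → 𝕜) {φ : Module.End 𝕜 (List X →₀ 𝕜)}
    (hφ : φ ∈ (wordGenerators D ψ).upper 𝕜) : φ (emptyWord 𝕜 X) = 0 := by
  refine lie_mem_of_mem_lieSpan (S := Submodule.span 𝕜 {emptyWord 𝕜 X}) (S' := ⊥) bot_le ?_ hφ _
    (Submodule.mem_span_singleton_self _)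
  rintro _ ⟨x, rfl⟩ w hw
  obtain ⟨c, rfl⟩ := Submodule.mem_span_singleton.1 hw
  rw [lie_smul]
  exact (congrArg (c • ·) (wordRaise_emptyWord D ψ x)).trans (smul_zero c)

variable (t : D.Generators L) (χ : L →ₗ[𝕜] 𝕜)

lemma apply_emptyWord_of_mem_diagonal_prod {g : L × Module.End 𝕜 (List X →₀ 𝕜)}
    (hg : g ∈ (t.prod (wordGenerators D fun z => χ (t.h z))).diagonal 𝕜) :
    g.2 (emptyWord 𝕜 X) = χ g.1 • emptyWord 𝕜 X := by
  induction hg using Submodule.span_induction with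
  | mem g hg =>
    obtain ⟨z, rfl⟩ := hg
    exact wordDiagonal_emptyWord D (fun z => χ (t.h z)) z
  | zero => simp
  | add g g' _ _ hg hg' =>
    rw [Prod.snd_add, Prod.fst_add, LinearMap.add_apply, hg, hg', map_add, add_smul]
  | smul c g _ hg =>
    rw [Prod.smul_snd, Prod.smul_fst, LinearMap.smul_apply, hg, map_smul, smul_assoc]

lemma emptyCoeff_eq_zero_of_mem_span_prod [CharZero 𝕜] {φ : Module.End 𝕜 (List X →₀ 𝕜)}
    (hφ : (0, φ) ∈ (t.prod (wordGenerators D fun z => χ (t.h z))).span 𝕜) (w : List X →₀ 𝕜) :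
    emptyCoeff (φ w) = 0 := by
  set G := (t.prod (wordGenerators D fun z => χ (t.h z))).span 𝕜
  suffices h : ∀ w, ∀ φ, (0, φ) ∈ G → emptyCoeff (φ w) = 0 from h w φ hφ
  let S : Submodule 𝕜 (List X →₀ 𝕜) :=
    { carrier := {w | ∀ φ, (0, φ) ∈ G → emptyCoeff (φ w) = 0}
      add_mem' := fun hu hw φ hφ => by rw [map_add, map_add, hu φ hφ, hw φ hφ, add_zero]
      zero_mem' := fun φ _ => by rw [map_zero, map_zero]
      smul_mem' := fun c w hw φ hφ => by rw [map_smul, map_smul, hw φ hφ, smul_zero] }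
  suffices hS : S = ⊤ from fun w => (hS ▸ Submodule.mem_top : w ∈ S)
  refine eq_top_of_consWord_mem ?_ fun x w hw φ hφ => ?_
  · intro φ hφ
    obtain ⟨a, ha, b, hb, c, hc, rfl⟩ := t.exists_diagonal_of_mem_span_prod _ hφ
    rw [LinearMap.add_apply, LinearMap.add_apply, map_add, map_add,
      emptyCoeff_eq_zero_of_mem_lower _ ha, apply_emptyWord_of_mem_diagonal_prod t χ hb,
      apply_emptyWord_eq_zero_of_mem_upper _ hc]
    simp
  · have hmem : (0, ⁅φ, consWord x⁆) ∈ G := by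
      have := G.lie_mem hφ ((t.prod (wordGenerators D fun z => χ (t.h z))).f_mem_span x)
      rwa [show ⁅((0 : L), φ), (t.prod (wordGenerators D fun z => χ (t.h z))).f x⁆ =
        (0, ⁅φ, consWord x⁆) from Prod.ext (zero_lie _) rfl] at this
    have hcomm : φ (consWord x w) = ⁅φ, consWord x⁆ w + consWord x (φ w) :=
      (sub_add_cancel (φ (consWord x w)) (consWord x (φ w))).symm
    rw [hcomm, map_add, hw _ hmem, emptyCoeff_consWord, add_zero]

theorem exists_highestWeight_rep [CharZero 𝕜] (ht : t.span 𝕜 = ⊤) :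
    ∃ (Q : Type (max u v)) (_ : AddCommGroup Q) (_ : Module 𝕜 Q) (ρ : L →ₗ⁅𝕜⁆ Module.End 𝕜 Q)
      (v : Q), v ≠ 0 ∧ (∀ x, ρ (t.e x) v = 0) ∧ ∀ z, ρ (t.h z) v = χ (t.h z) • v := by
  set t' := t.prod (wordGenerators D fun z => χ (t.h z))
  let _ := LieRingModule.compLieHom (List X →₀ 𝕜)
    ((LieHom.snd 𝕜 L (Module.End 𝕜 (List X →₀ 𝕜))).comp (t'.span 𝕜).incl)
  let _ := LieModule.compLieHom (List X →₀ 𝕜)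
    ((LieHom.snd 𝕜 L (Module.End 𝕜 (List X →₀ 𝕜))).comp (t'.span 𝕜).incl)
  let π : t'.span 𝕜 →ₗ⁅𝕜⁆ L := (LieHom.fst 𝕜 L (Module.End 𝕜 (List X →₀ 𝕜))).comp (t'.span 𝕜).incl
  have hπ : Function.Surjective π := by
    intro a
    obtain ⟨g, hg, rfl⟩ : a ∈ (t'.span 𝕜).map (LieHom.fst 𝕜 L _) := by
      rw [t.map_fst_span_prod, ht]
      trivial
    exact ⟨⟨g, hg⟩, rfl⟩
  obtain ⟨ρ, hρ⟩ := exists_lieHom_end_quotient (M := List X →₀ 𝕜) hπ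
  refine ⟨_, _, _, ρ, LieSubmodule.Quotient.mk (emptyWord 𝕜 X), fun hv => ?_, fun x => ?_,
    fun z => ?_⟩
  · have hk : ∀ g : t'.span 𝕜, π g = 0 → ∀ w : List X →₀ 𝕜, emptyCoeff ⁅g, w⁆ = 0 := by
      rintro ⟨⟨_, φ⟩, hφ⟩ rfl w
      exact emptyCoeff_eq_zero_of_mem_span_prod t χ hφ w
    have h := linearMap_eq_zero_of_mem_ker_lie hk ((LieSubmodule.Quotient.mk_eq_zero _).1 hv)
    exact one_ne_zero (emptyCoeff_emptyWord.symm.trans h)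
  · refine (hρ ⟨t'.e x, t'.e_mem_span x⟩ _).trans ?_
    rw [show ⁅(⟨t'.e x, t'.e_mem_span x⟩ : t'.span 𝕜), emptyWord 𝕜 X⁆ = 0 from
      wordRaise_emptyWord _ _ x]
    exact (LieSubmodule.Quotient.mk' _).map_zero
  · refine (hρ ⟨t'.h z, t'.h_mem_span z⟩ _).trans ?_
    rw [show ⁅(⟨t'.h z, t'.h_mem_span z⟩ : t'.span 𝕜), emptyWord 𝕜 X⁆ =
      χ (t.h z) • emptyWord 𝕜 X from wordDiagonal_emptyWord D (fun z => χ (t.h z)) z]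
    exact (LieSubmodule.Quotient.mk' _).map_smul _ _

end Existence

section OffEigenspaceMap

variable {𝕜 V V' : Type*} [Field 𝕜] [AddCommGroup V] [Module 𝕜 V] [AddCommGroup V'] [Module 𝕜 V']

lemma offEigenspace_le_comap {T : Module.End 𝕜 V} {T' : Module.End 𝕜 V'} {φ : V →ₗ[𝕜] V'}
    (h : ∀ w, φ (T w) = T' (φ w)) (c : 𝕜) : offEigenspace T c ≤ (offEigenspace T' c).comap φ := by
  refine iSup₂_le fun μ hμ w hw => Submodule.mem_iSup_of_mem μ (Submodule.mem_iSup_of_mem hμ ?_)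
  rw [Module.End.mem_eigenspace_iff] at hw ⊢
  rw [← h, hw, map_smul]

end OffEigenspaceMap

namespace TriangularData.Generators

variable {X Z 𝕜 L V : Type*} {D : TriangularData X Z} [Field 𝕜] [LieRing L] [AddCommGroup V]
  [Module 𝕜 V] [LieRingModule L V] (t : D.Generators L)

lemma lie_e_lie_f (x y : X) (w : V) :
    ⁅t.e x, ⁅t.f y, w⁆⁆ = ⁅t.h (D.pairing x y), w⁆ + ⁅t.f y, ⁅t.e x, w⁆⁆ := by
  rw [leibniz_lie, t.lie_e_f]

lemma lie_h_lie_e (z : Z) (x : X) (w : V) :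
    ⁅t.h z, ⁅t.e x, w⁆⁆ = ⁅t.e (D.act z x), w⁆ + ⁅t.e x, ⁅t.h z, w⁆⁆ := by
  rw [leibniz_lie, t.lie_h_e]

lemma lie_h_lie_f (z : Z) (x : X) (w : V) :
    ⁅t.h z, ⁅t.f x, w⁆⁆ = -⁅t.f (D.act z x), w⁆ + ⁅t.f x, ⁅t.h z, w⁆⁆ := by
  rw [leibniz_lie, t.lie_h_f, neg_lie]

variable (𝕜) in
/-- The smallest subspace containing `s` and stable under the lowering generators. -/
def lowerSpan (s : Set V) : Submodule 𝕜 V :=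
  sInf {S | s ⊆ S ∧ ∀ x, ∀ w ∈ S, ⁅t.f x, w⁆ ∈ S}

lemma subset_lowerSpan (s : Set V) : s ⊆ t.lowerSpan 𝕜 s :=
  fun _ hw => Submodule.mem_sInf.2 fun _ hS => hS.1 hw

lemma lie_f_mem_lowerSpan {s : Set V} (x : X) {w : V} (hw : w ∈ t.lowerSpan 𝕜 s) :
    ⁅t.f x, w⁆ ∈ t.lowerSpan 𝕜 s :=
  Submodule.mem_sInf.2 fun S hS => hS.2 x w (Submodule.mem_sInf.1 hw S hS)

lemma lowerSpan_le {s : Set V} {S : Submodule 𝕜 V} (hs : s ⊆ S)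
    (hS : ∀ x, ∀ w ∈ S, ⁅t.f x, w⁆ ∈ S) : t.lowerSpan 𝕜 s ≤ S :=
  sInf_le ⟨hs, hS⟩

variable (𝕜) in
/-- `v` is a vector of weight `ψ` killed by the raising generators, and generates the module. -/
structure IsCyclicHighestWeight (ψ : Z → 𝕜) (v : V) : Prop where
  lie_e : ∀ x, ⁅t.e x, v⁆ = 0
  lie_h : ∀ z, ⁅t.h z, v⁆ = ψ z • v
  lowerSpan_eq_top : t.lowerSpan 𝕜 {v} = ⊤

namespace IsCyclicHighestWeight

variable {t} {ψ : Z → 𝕜} {v : V} (hv : t.IsCyclicHighestWeight 𝕜 ψ v)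
include hv

lemma eq_top {S : Submodule 𝕜 V} (hvS : v ∈ S) (hS : ∀ x, ∀ w ∈ S, ⁅t.f x, w⁆ ∈ S) : S = ⊤ :=
  top_le_iff.1 <| hv.lowerSpan_eq_top ▸ t.lowerSpan_le (Set.singleton_subset_iff.2 hvS) hS

lemma eq_top_of_mem {N : LieSubmodule 𝕜 L V} (hN : v ∈ N) : N = ⊤ :=
  LieSubmodule.toSubmodule_injective (hv.eq_top hN fun _ _ hw => N.lie_mem hw)

lemma ne_zero [LieModule.IsIrreducible 𝕜 L V] : v ≠ 0 := by
  rintro rfl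
  exact bot_ne_top (hv.eq_top_of_mem (zero_mem (⊥ : LieSubmodule 𝕜 L V)))

lemma map {V' : Type*} [AddCommGroup V'] [Module 𝕜 V'] [LieRingModule L V'] {φ : V →ₗ⁅𝕜,L⁆ V'}
    (hφ : Function.Surjective φ) : t.IsCyclicHighestWeight 𝕜 ψ (φ v) where
  lie_e x := by rw [← LieModuleHom.map_lie, hv.lie_e, map_zero]
  lie_h z := by rw [← LieModuleHom.map_lie, hv.lie_h, map_smul]
  lowerSpan_eq_top := by
    have h : (t.lowerSpan 𝕜 {φ v}).comap (φ : V →ₗ[𝕜] V') = ⊤ :=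
      hv.eq_top (t.subset_lowerSpan _ rfl) fun x w hw => by
        rw [Submodule.mem_comap, LieModuleHom.coe_toLinearMap, LieModuleHom.map_lie]
        exact t.lie_f_mem_lowerSpan x hw
    refine eq_top_iff.2 fun w' _ => ?_
    obtain ⟨w, rfl⟩ := hφ w'
    exact h.ge (Submodule.mem_top (x := w))

end IsCyclicHighestWeight

variable [LieAlgebra 𝕜 L] [LieModule 𝕜 L V]

lemma lie_f_mem_eigenspace {μ : 𝕜} {w : V}
    (hw : w ∈ (LieModule.toEnd 𝕜 L V (t.h D.grading)).eigenspace μ) (x : X) :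
    ⁅t.f x, w⁆ ∈ (LieModule.toEnd 𝕜 L V (t.h D.grading)).eigenspace (μ - 1) := by
  rw [Module.End.mem_eigenspace_iff, LieModule.toEnd_apply_apply] at hw ⊢
  rw [t.lie_h_lie_f, D.act_grading, hw, lie_smul]
  module

lemma lie_h_mem_lowerSpan {s : Set V} (hh : ∀ z, ∀ w ∈ s, ⁅t.h z, w⁆ ∈ t.lowerSpan 𝕜 s) (z : Z)
    {w : V} (hw : w ∈ t.lowerSpan 𝕜 s) : ⁅t.h z, w⁆ ∈ t.lowerSpan 𝕜 s := by
  suffices h : t.lowerSpan 𝕜 s ≤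
      t.lowerSpan 𝕜 s ⊓ ⨅ z, (t.lowerSpan 𝕜 s).comap (LieModule.toEnd 𝕜 L V (t.h z)) from
    (Submodule.mem_iInf _).1 (h hw).2 z
  refine t.lowerSpan_le (fun w hw => ⟨t.subset_lowerSpan s hw,
    (Submodule.mem_iInf _).2 fun z => hh z w hw⟩) ?_
  rintro x w ⟨hw, hhw⟩
  refine ⟨t.lie_f_mem_lowerSpan x hw, (Submodule.mem_iInf _).2 fun z => ?_⟩
  rw [Submodule.mem_comap, LieModule.toEnd_apply_apply, t.lie_h_lie_f]
  exact add_mem (neg_mem (t.lie_f_mem_lowerSpan _ hw))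
    (t.lie_f_mem_lowerSpan x ((Submodule.mem_iInf _).1 hhw z))

lemma lie_e_mem_lowerSpan {s : Set V} (hh : ∀ z, ∀ w ∈ s, ⁅t.h z, w⁆ ∈ t.lowerSpan 𝕜 s)
    (he : ∀ x, ∀ w ∈ s, ⁅t.e x, w⁆ ∈ t.lowerSpan 𝕜 s) (x : X) {w : V}
    (hw : w ∈ t.lowerSpan 𝕜 s) : ⁅t.e x, w⁆ ∈ t.lowerSpan 𝕜 s := by
  suffices h : t.lowerSpan 𝕜 s ≤
      t.lowerSpan 𝕜 s ⊓ ⨅ x, (t.lowerSpan 𝕜 s).comap (LieModule.toEnd 𝕜 L V (t.e x)) from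
    (Submodule.mem_iInf _).1 (h hw).2 x
  refine t.lowerSpan_le (fun w hw => ⟨t.subset_lowerSpan s hw,
    (Submodule.mem_iInf _).2 fun x => he x w hw⟩) ?_
  rintro y w ⟨hw, hew⟩
  refine ⟨t.lie_f_mem_lowerSpan y hw, (Submodule.mem_iInf _).2 fun x => ?_⟩
  rw [Submodule.mem_comap, LieModule.toEnd_apply_apply, t.lie_e_lie_f]
  exact add_mem (t.lie_h_mem_lowerSpan hh _ hw)
    (t.lie_f_mem_lowerSpan y ((Submodule.mem_iInf _).1 hew x))

lemma lie_mem_of_span_eq_top (ht : t.span 𝕜 = ⊤) {S : Submodule 𝕜 V}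
    (he : ∀ x, ∀ w ∈ S, ⁅t.e x, w⁆ ∈ S) (hf : ∀ x, ∀ w ∈ S, ⁅t.f x, w⁆ ∈ S)
    (hh : ∀ z, ∀ w ∈ S, ⁅t.h z, w⁆ ∈ S) (a : L) {w : V} (hw : w ∈ S) : ⁅a, w⁆ ∈ S := by
  refine lie_mem_of_mem_lieSpan le_rfl ?_ (ht ▸ LieSubalgebra.mem_top a : a ∈ t.span 𝕜) w hw
  rintro _ ((⟨x, rfl⟩ | ⟨x, rfl⟩) | ⟨z, rfl⟩)
  exacts [he x, hf x, hh z]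

lemma lie_mem_lowerSpan (ht : t.span 𝕜 = ⊤) {s : Set V}
    (hh : ∀ z, ∀ w ∈ s, ⁅t.h z, w⁆ ∈ t.lowerSpan 𝕜 s)
    (he : ∀ x, ∀ w ∈ s, ⁅t.e x, w⁆ ∈ t.lowerSpan 𝕜 s) (a : L) {w : V}
    (hw : w ∈ t.lowerSpan 𝕜 s) : ⁅a, w⁆ ∈ t.lowerSpan 𝕜 s :=
  t.lie_mem_of_span_eq_top ht (fun x _ => t.lie_e_mem_lowerSpan hh he x)
    (fun x _ => t.lie_f_mem_lowerSpan x) (fun z _ => t.lie_h_mem_lowerSpan hh z) a hw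

variable (𝕜 V) in
/-- The span of the images of the lowering generators. -/
def lowered : Submodule 𝕜 V :=
  ⨆ x, (LieModule.toEnd 𝕜 L V (t.f x)).range

lemma lie_f_mem_lowered (x : X) (w : V) : ⁅t.f x, w⁆ ∈ t.lowered 𝕜 V :=
  Submodule.mem_iSup_of_mem x ⟨w, rfl⟩

lemma lowered_le {S : Submodule 𝕜 V} (hS : ∀ x (w : V), ⁅t.f x, w⁆ ∈ S) : t.lowered 𝕜 V ≤ S := by
  refine iSup_le fun x => ?_
  rintro _ ⟨w, rfl⟩
  exact hS x w

lemma lie_h_mem_lowered (z : Z) {w : V} (hw : w ∈ t.lowered 𝕜 V) : ⁅t.h z, w⁆ ∈ t.lowered 𝕜 V := by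
  refine (t.lowered_le fun x w => ?_ :
    t.lowered 𝕜 V ≤ (t.lowered 𝕜 V).comap (LieModule.toEnd 𝕜 L V (t.h z))) hw
  rw [Submodule.mem_comap, LieModule.toEnd_apply_apply, t.lie_h_lie_f]
  exact add_mem (neg_mem (t.lie_f_mem_lowered _ _)) (t.lie_f_mem_lowered _ _)

namespace IsCyclicHighestWeight

variable {t} {ψ : Z → 𝕜} {v : V} (hv : t.IsCyclicHighestWeight 𝕜 ψ v)
include hv

lemma exists_eq_smul_add (w : V) : ∃ a : 𝕜, ∃ u ∈ t.lowered 𝕜 V, w = a • v + u := by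
  have h : w ∈ Submodule.span 𝕜 {v} ⊔ t.lowered 𝕜 V := by
    rw [hv.eq_top (Submodule.mem_sup_left (Submodule.mem_span_singleton_self v))
      fun x w _ => Submodule.mem_sup_right (t.lie_f_mem_lowered x w)]
    trivial
  obtain ⟨_, hy, u, hu, rfl⟩ := Submodule.mem_sup.1 h
  obtain ⟨a, rfl⟩ := Submodule.mem_span_singleton.1 hy
  exact ⟨a, u, hu, rfl⟩

lemma iSup_eigenspace_grading_eq_top :
    ⨆ m : ℕ, (LieModule.toEnd 𝕜 L V (t.h D.grading)).eigenspace (ψ D.grading - m) = ⊤ := by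
  refine hv.eq_top (Submodule.mem_iSup_of_mem 0 ?_) fun x w hw => ?_
  · rw [Module.End.mem_eigenspace_iff, Nat.cast_zero, sub_zero]
    exact hv.lie_h D.grading
  · refine (iSup_le fun m w hw => Submodule.mem_iSup_of_mem (m + 1) ?_ : _ ≤ Submodule.comap
      (LieModule.toEnd 𝕜 L V (t.f x)) (⨆ m : ℕ, Module.End.eigenspace _ (ψ D.grading - m))) hw
    rw [Nat.cast_add_one, ← sub_sub]
    exact t.lie_f_mem_eigenspace hw x

lemma lowered_le_offEigenspace [CharZero 𝕜] :
    t.lowered 𝕜 V ≤ offEigenspace (LieModule.toEnd 𝕜 L V (t.h D.grading)) (ψ D.grading) := by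
  refine le_trans (t.lowered_le fun x w => ?_) (iSup_eigenspace_le_offEigenspace
    (μ := fun m : ℕ => ψ D.grading - (m + 1)) _ fun m => ?_)
  · have hw := hv.iSup_eigenspace_grading_eq_top.ge (Submodule.mem_top (x := w))
    refine (iSup_le fun m w hw => Submodule.mem_iSup_of_mem m ?_ : _ ≤ Submodule.comap
      (LieModule.toEnd 𝕜 L V (t.f x))
      (⨆ m : ℕ, Module.End.eigenspace _ (ψ D.grading - (m + 1)))) hw
    rw [← sub_sub]
    exact t.lie_f_mem_eigenspace hw x
  · rw [Ne, sub_eq_self]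
    exact Nat.cast_add_one_ne_zero m

lemma eq_zero_of_smul_add_eq_zero [CharZero 𝕜] {N : LieSubmodule 𝕜 L V} (hN : v ∉ N) {a : 𝕜}
    {u : V} (hu : u ∈ t.lowered 𝕜 V) (h : a • v + u ∈ N) : a = 0 := by
  set T := LieModule.toEnd 𝕜 L (V ⧸ N) (t.h D.grading)
  have hvT : a • LieSubmodule.Quotient.mk' N v ∈ T.eigenspace (ψ D.grading) := by
    refine Submodule.smul_mem _ a (Module.End.mem_eigenspace_iff.2 ?_)
    rw [LieModule.toEnd_apply_apply, ← LieModuleHom.map_lie, hv.lie_h, map_smul]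
  have huT : LieSubmodule.Quotient.mk' N u ∈ offEigenspace T (ψ D.grading) :=
    offEigenspace_le_comap (φ := (LieSubmodule.Quotient.mk' N : V →ₗ[𝕜] V ⧸ N))
      (fun w => LieModuleHom.map_lie _ _ w) _ (hv.lowered_le_offEigenspace hu)
  have hmk : a • LieSubmodule.Quotient.mk' N v = -LieSubmodule.Quotient.mk' N u := by
    rw [← add_eq_zero_iff_eq_neg, ← map_smul, ← map_add]
    exact (LieSubmodule.Quotient.mk_eq_zero N).2 h
  have h₀ := Submodule.disjoint_def.1 (disjoint_eigenspace_offEigenspace T (ψ D.grading)) _ hvT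
    (hmk ▸ neg_mem huT)
  exact (smul_eq_zero.1 h₀).resolve_right fun h => hN ((LieSubmodule.Quotient.mk_eq_zero N).1 h)

lemma le_lowered [CharZero 𝕜] {N : LieSubmodule 𝕜 L V} (hN : v ∉ N) :
    N.toSubmodule ≤ t.lowered 𝕜 V := by
  intro w hw
  obtain ⟨a, u, hu, rfl⟩ := hv.exists_eq_smul_add w
  rwa [hv.eq_zero_of_smul_add_eq_zero hN hu hw, zero_smul, zero_add]

lemma notMem_lowered [CharZero 𝕜] (hv₀ : v ≠ 0) : v ∉ t.lowered 𝕜 V := by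
  intro h
  have : (1 : 𝕜) = 0 := hv.eq_zero_of_smul_add_eq_zero (N := ⊥) (by simpa using hv₀)
    (neg_mem h) (by simp)
  exact one_ne_zero this

end IsCyclicHighestWeight
end TriangularData.Generators

namespace TriangularData.Generators

variable {X Z 𝕜 L V : Type*} {D : TriangularData X Z} [Field 𝕜] [LieRing L] [LieAlgebra 𝕜 L]
  [AddCommGroup V] [Module 𝕜 V] [LieRingModule L V] [LieModule 𝕜 L V] {t : D.Generators L}

lemma lie_e_mem_eigenspace {μ : 𝕜} {w : V}
    (hw : w ∈ (LieModule.toEnd 𝕜 L V (t.h D.grading)).eigenspace μ) (x : X) :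
    ⁅t.e x, w⁆ ∈ (LieModule.toEnd 𝕜 L V (t.h D.grading)).eigenspace (μ + 1) := by
  rw [Module.End.mem_eigenspace_iff, LieModule.toEnd_apply_apply] at hw ⊢
  rw [t.lie_h_lie_e, D.act_grading, hw, lie_smul]
  module

namespace IsCyclicHighestWeight

variable [CharZero 𝕜] {ψ : Z → 𝕜} {v : V} (hv : t.IsCyclicHighestWeight 𝕜 ψ v)
include hv

lemma lowerSpan_eq_bot [LieModule.IsIrreducible 𝕜 L V] (ht : t.span 𝕜 = ⊤) {s : Set V}
    (hs : t.lowerSpan 𝕜 s ≤ t.lowered 𝕜 V) (hh : ∀ z, ∀ w ∈ s, ⁅t.h z, w⁆ ∈ t.lowerSpan 𝕜 s)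
    (he : ∀ x, ∀ w ∈ s, ⁅t.e x, w⁆ ∈ t.lowerSpan 𝕜 s) : t.lowerSpan 𝕜 s = ⊥ := by
  let N : LieSubmodule 𝕜 L V :=
    { t.lowerSpan 𝕜 s with lie_mem := fun hw => t.lie_mem_lowerSpan ht hh he _ hw }
  have hN : N ≠ ⊤ := fun h => hv.notMem_lowered hv.ne_zero <| hs (h.ge (LieSubmodule.mem_top v))
  exact congrArg LieSubmodule.toSubmodule ((eq_bot_or_eq_top N).resolve_right hN)

lemma exists_eq_smul [LieModule.IsIrreducible 𝕜 L V] (ht : t.span 𝕜 = ⊤) {w : V}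
    (hw : ∀ x, ⁅t.e x, w⁆ = 0) : ∃ a : 𝕜, w = a • v := by
  obtain ⟨a, u, hu, rfl⟩ := hv.exists_eq_smul_add w
  have hu' : ∀ x, ⁅t.e x, u⁆ = 0 := fun x => by
    simpa only [lie_add, lie_smul, hv.lie_e, smul_zero, zero_add] using hw x
  let s : Set V := {u | u ∈ t.lowered 𝕜 V ∧ ∀ x, ⁅t.e x, u⁆ = 0}
  have hs : t.lowerSpan 𝕜 s = ⊥ := by
    refine hv.lowerSpan_eq_bot ht ?_ (fun z u hu => t.subset_lowerSpan s ?_) fun x u hu => ?_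
    · exact t.lowerSpan_le (fun u hu => hu.1) fun x w _ => t.lie_f_mem_lowered x w
    · refine ⟨t.lie_h_mem_lowered z hu.1, fun x => ?_⟩
      rw [← add_left_cancel_iff (a := ⁅t.e (D.act z x), u⁆), ← t.lie_h_lie_e]
      simp only [hu.2, lie_zero, add_zero]
    · rw [hu.2 x]
      exact zero_mem _
  have hu₀ : u ∈ t.lowerSpan 𝕜 s := t.subset_lowerSpan s ⟨hu, hu'⟩
  exact ⟨a, by rw [(Submodule.mem_bot 𝕜).1 (hs.le hu₀), add_zero]⟩

lemma lie_e_eq_zero_of_mem_eigenspace {w : V}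
    (hw : w ∈ (LieModule.toEnd 𝕜 L V (t.h D.grading)).eigenspace (ψ D.grading)) (x : X) :
    ⁅t.e x, w⁆ = 0 := by
  refine Submodule.disjoint_def.1 (disjoint_eigenspace_offEigenspace _ _) _
    (t.lie_e_mem_eigenspace hw x) ?_
  refine iSup_eigenspace_le_offEigenspace (μ := fun m : ℕ => ψ D.grading - m) _ (fun m h => ?_)
    (hv.iSup_eigenspace_grading_eq_top.ge Submodule.mem_top)
  have : (m : 𝕜) + 1 = 0 := by linear_combination -h
  exact Nat.cast_add_one_ne_zero m this

lemma lie_e_mem_iSup_eigenspace {k : ℕ} {w : V} (hw : w ∈ ⨆ m ∈ Finset.range (k + 1),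
      (LieModule.toEnd 𝕜 L V (t.h D.grading)).eigenspace (ψ D.grading - m)) (x : X) :
    ⁅t.e x, w⁆ ∈ ⨆ m ∈ Finset.range k,
      (LieModule.toEnd 𝕜 L V (t.h D.grading)).eigenspace (ψ D.grading - m) := by
  refine (iSup₂_le fun m hm w hw => ?_ :
    _ ≤ Submodule.comap (LieModule.toEnd 𝕜 L V (t.e x)) (⨆ m ∈ Finset.range k, _)) hw
  rw [Submodule.mem_comap, LieModule.toEnd_apply_apply]
  rcases m with _ | m
  · rw [Nat.cast_zero, sub_zero] at hw
    rw [hv.lie_e_eq_zero_of_mem_eigenspace hw]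
    exact zero_mem _
  · refine Submodule.mem_iSup_of_mem m (Submodule.mem_iSup_of_mem (by simpa using hm) ?_)
    convert t.lie_e_mem_eigenspace hw x using 2
    push_cast
    ring

lemma exists_ne_zero_forall_lie_e_eq_zero {N : LieSubmodule 𝕜 L V} (hN : N ≠ ⊥) :
    ∃ w ∈ N, w ≠ 0 ∧ ∀ x, ⁅t.e x, w⁆ = 0 := by
  obtain ⟨w, hwN, hw₀⟩ := N.toSubmodule.ne_bot_iff.1
    fun h => hN (LieSubmodule.toSubmodule_injective h)
  have hw := hv.iSup_eigenspace_grading_eq_top.ge (Submodule.mem_top (x := w))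
  obtain ⟨s, hs⟩ := Submodule.mem_iSup_iff_exists_finset.1 hw
  obtain ⟨k, hk⟩ := s.exists_nat_subset_range
  replace hs := (biSup_mono fun _ hm => hk hm :
    _ ≤ ⨆ m ∈ Finset.range k, Module.End.eigenspace _ (ψ D.grading - m)) hs
  clear hw hk s
  induction k generalizing w with
  | zero => simp [hw₀] at hs
  | succ k ih =>
    by_cases hw' : ∀ x, ⁅t.e x, w⁆ = 0
    · exact ⟨w, hwN, hw₀, hw'⟩
    · obtain ⟨x, hx⟩ := not_forall.1 hw'
      exact ih _ (N.lie_mem hwN) hx (hv.lie_e_mem_iSup_eigenspace hs x)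

lemma isIrreducible (hv₀ : v ≠ 0)
    (h : ∀ w : V, (∀ x, ⁅t.e x, w⁆ = 0) → ∃ a : 𝕜, w = a • v) : LieModule.IsIrreducible 𝕜 L V := by
  have : Nontrivial V := ⟨v, 0, hv₀⟩
  refine LieModule.IsIrreducible.mk fun N hN => ?_
  obtain ⟨w, hwN, hw₀, hw⟩ := hv.exists_ne_zero_forall_lie_e_eq_zero hN
  obtain ⟨a, rfl⟩ := h w hw
  exact hv.eq_top_of_mem ((N.toSubmodule.smul_mem_iff (left_ne_zero_of_smul hw₀)).1 hwN)

end IsCyclicHighestWeight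
end TriangularData.Generators

/-- Index sets `S ⊆ X` and `Y ⊆ Z` which span an ideal in any Lie algebra generated by generators
of type `D`. -/
structure TriangularData.IsIdeal {X Z : Type*} (D : TriangularData X Z) (S : Set X) (Y : Set Z) :
    Prop where
  act_mem : ∀ z, ∀ x ∈ S, D.act z x ∈ S
  act_mem_of_mem : ∀ z ∈ Y, ∀ x, D.act z x ∈ S
  pairing_mem_left : ∀ x ∈ S, ∀ y, D.pairing x y ∈ Y
  pairing_mem_right : ∀ x, ∀ y ∈ S, D.pairing x y ∈ Y

namespace TriangularData.Generators

variable {X Z 𝕜 L V : Type*} {D : TriangularData X Z} [Field 𝕜] [LieRing L] [AddCommGroup V]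
  [Module 𝕜 V] [LieRingModule L V] {t : D.Generators L}

variable (t V) in
/-- The images of the lowering generators with index in `S`. -/
def loweredBy (S : Set X) : Set V :=
  Set.image2 (fun x w => ⁅t.f x, w⁆) S Set.univ

variable (t) in
lemma lie_f_mem_lowerSpan_loweredBy {S : Set X} {x : X} (hx : x ∈ S) (w : V) :
    ⁅t.f x, w⁆ ∈ t.lowerSpan 𝕜 (t.loweredBy V S) :=
  t.subset_lowerSpan _ ⟨x, hx, w, trivial, rfl⟩

namespace IsCyclicHighestWeight

variable [LieAlgebra 𝕜 L] [LieModule 𝕜 L V]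
variable {ψ : Z → 𝕜} {v : V} (hv : t.IsCyclicHighestWeight 𝕜 ψ v) {S : Set X} {Y : Set Z}
  (hI : D.IsIdeal S Y) (hψ : ∀ z ∈ Y, ψ z = 0)
include hv hI hψ

lemma lie_h_mem_lowerSpan_loweredBy {z : Z} (hz : z ∈ Y) (w : V) :
    ⁅t.h z, w⁆ ∈ t.lowerSpan 𝕜 (t.loweredBy V S) := by
  have h : (t.lowerSpan 𝕜 (t.loweredBy V S)).comap (LieModule.toEnd 𝕜 L V (t.h z)) = ⊤ := by
    refine hv.eq_top ?_ fun x w hw => ?_ <;>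
      rw [Submodule.mem_comap, LieModule.toEnd_apply_apply] at *
    · rw [hv.lie_h, hψ z hz, zero_smul]
      exact zero_mem _
    · rw [t.lie_h_lie_f]
      exact add_mem (neg_mem (t.lie_f_mem_lowerSpan_loweredBy (hI.act_mem_of_mem z hz x) w))
        (t.lie_f_mem_lowerSpan x hw)
  exact h.ge (Submodule.mem_top (x := w))

variable [CharZero 𝕜] [LieModule.IsIrreducible 𝕜 L V] (ht : t.span 𝕜 = ⊤)
include ht

lemma lowerSpan_loweredBy_eq_bot : t.lowerSpan 𝕜 (t.loweredBy V S) = ⊥ := by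
  refine hv.lowerSpan_eq_bot ht (t.lowerSpan_le ?_ fun x w _ => t.lie_f_mem_lowered x w) ?_ ?_
  · rintro _ ⟨x, -, w, -, rfl⟩
    exact t.lie_f_mem_lowered x w
  · rintro z _ ⟨x, hx, w, -, rfl⟩
    rw [t.lie_h_lie_f]
    exact add_mem (neg_mem (t.lie_f_mem_lowerSpan_loweredBy (hI.act_mem z x hx) w))
      (t.lie_f_mem_lowerSpan_loweredBy hx _)
  · rintro y _ ⟨x, hx, w, -, rfl⟩
    rw [t.lie_e_lie_f]
    exact add_mem (hv.lie_h_mem_lowerSpan_loweredBy hI hψ (hI.pairing_mem_right y x hx) w)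
      (t.lie_f_mem_lowerSpan_loweredBy hx _)

lemma lie_f_eq_zero {x : X} (hx : x ∈ S) (w : V) : ⁅t.f x, w⁆ = 0 :=
  (Submodule.mem_bot 𝕜).1 <|
    (hv.lowerSpan_loweredBy_eq_bot hI hψ ht).le (t.lie_f_mem_lowerSpan_loweredBy hx w)

lemma lie_e_eq_zero {x : X} (hx : x ∈ S) (w : V) : ⁅t.e x, w⁆ = 0 := by
  have h : (LieModule.toEnd 𝕜 L V (t.e x)).ker = ⊤ := by
    refine hv.eq_top ?_ fun y w hw => ?_ <;>
      rw [LinearMap.mem_ker, LieModule.toEnd_apply_apply] at *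
    · exact hv.lie_e x
    · rw [t.lie_e_lie_f, hw, lie_zero, add_zero, ← Submodule.mem_bot 𝕜,
        ← hv.lowerSpan_loweredBy_eq_bot hI hψ ht]
      exact hv.lie_h_mem_lowerSpan_loweredBy hI hψ (hI.pairing_mem_left x hx y) w
  exact h.ge (Submodule.mem_top (x := w))

end IsCyclicHighestWeight

/-- Every raising or lowering generator acts on `V₁` like one which kills `V₂`. -/
structure Isolates (t : D.Generators L) (V₁ V₂ : Type*) [AddCommGroup V₁] [LieRingModule L V₁]
    [AddCommGroup V₂] [LieRingModule L V₂] : Prop where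
  lie_e : ∀ x, ∃ y, (∀ w : V₁, ⁅t.e y, w⁆ = ⁅t.e x, w⁆) ∧ ∀ w : V₂, ⁅t.e y, w⁆ = 0
  lie_f : ∀ x, ∃ y, (∀ w : V₁, ⁅t.f y, w⁆ = ⁅t.f x, w⁆) ∧ ∀ w : V₂, ⁅t.f y, w⁆ = 0

end TriangularData.Generators

section Tensor

variable {𝕜 V₁ V₂ : Type*} [Field 𝕜] [AddCommGroup V₁] [Module 𝕜 V₁] [AddCommGroup V₂] [Module 𝕜 V₂]

lemma tmul_right_injective {a : V₁} (ha : a ≠ 0) :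
    Function.Injective fun b : V₂ => a ⊗ₜ[𝕜] b := by
  convert (Module.Flat.rTensor_preserves_injective_linearMap (M := V₂)
    (LinearMap.toSpanSingleton 𝕜 V₁ a) (smul_left_injective 𝕜 ha)).comp
    (TensorProduct.lid 𝕜 V₂).symm.injective using 2 with b
  simp

lemma tmul_eq_zero_iff {a : V₁} {b : V₂} (ha : a ≠ 0) : a ⊗ₜ[𝕜] b = 0 ↔ b = 0 :=
  ⟨fun h => tmul_right_injective ha (h.trans (TensorProduct.tmul_zero V₂ a).symm),
    fun h => h ▸ TensorProduct.tmul_zero V₂ a⟩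

lemma exists_eq_tmul_of_rTensor_eq_zero {ι : Type*} {T : ι → Module.End 𝕜 V₁} {a : V₁}
    (hT : ∀ w, (∀ i, T i w = 0) → ∃ c : 𝕜, w = c • a) {w : V₁ ⊗[𝕜] V₂}
    (hw : ∀ i, (T i).rTensor V₂ w = 0) : ∃ b, w = a ⊗ₜ[𝕜] b := by
  let β := Module.Free.chooseBasis 𝕜 V₂
  obtain ⟨c, rfl⟩ := TensorProduct.eq_repr_basis_right β w
  have hc : ∀ k, ∃ r : 𝕜, c k = r • a := fun k => hT _ fun i => by
    refine DFunLike.congr_fun (TensorProduct.sum_tmul_basis_right_eq_zero β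
      (c.mapRange (T i) (map_zero _)) ?_) k
    rw [Finsupp.sum_mapRange_index fun k => TensorProduct.zero_tmul V₁ (β k)]
    simpa only [Finsupp.sum, map_sum, LinearMap.rTensor_tmul] using hw i
  choose r hr using hc
  refine ⟨c.sum fun k _ => r k • β k, ?_⟩
  simp only [Finsupp.sum, TensorProduct.tmul_sum, hr, TensorProduct.smul_tmul]

lemma lie_eq_rTensor {𝕜 L V₁ V₂ : Type*} [Field 𝕜] [LieRing L] [LieAlgebra 𝕜 L] [AddCommGroup V₁]
    [Module 𝕜 V₁] [LieRingModule L V₁] [LieModule 𝕜 L V₁] [AddCommGroup V₂] [Module 𝕜 V₂]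
    [LieRingModule L V₂] [LieModule 𝕜 L V₂] {a : L} (ha : ∀ w : V₂, ⁅a, w⁆ = 0) (w : V₁ ⊗[𝕜] V₂) :
    ⁅a, w⁆ = (LieModule.toEnd 𝕜 L V₁ a).rTensor V₂ w := by
  suffices LieModule.toEnd 𝕜 L (V₁ ⊗[𝕜] V₂) a = (LieModule.toEnd 𝕜 L V₁ a).rTensor V₂ from
    LinearMap.congr_fun this w
  refine TensorProduct.ext' fun w₁ w₂ => ?_
  rw [LieModule.toEnd_apply_apply, TensorProduct.LieModule.lie_tmul_right, ha,
    TensorProduct.tmul_zero, add_zero, LinearMap.rTensor_tmul, LieModule.toEnd_apply_apply]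

end Tensor

namespace TriangularData.Generators

variable {X Z 𝕜 L V₁ V₂ : Type*} {D : TriangularData X Z} [Field 𝕜] [LieRing L]
  [LieAlgebra 𝕜 L] [AddCommGroup V₁] [Module 𝕜 V₁] [LieRingModule L V₁] [LieModule 𝕜 L V₁]
  [AddCommGroup V₂] [Module 𝕜 V₂] [LieRingModule L V₂] [LieModule 𝕜 L V₂] {t : D.Generators L}
  {ψ₁ ψ₂ : Z → 𝕜} {v₁ : V₁} {v₂ : V₂}

namespace IsCyclicHighestWeight

variable (hv₁ : t.IsCyclicHighestWeight 𝕜 ψ₁ v₁) (hv₂ : t.IsCyclicHighestWeight 𝕜 ψ₂ v₂)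
  (h₁ : t.Isolates V₁ V₂) (h₂ : t.Isolates V₂ V₁)
include hv₁ hv₂ h₁ h₂

lemma tmul : t.IsCyclicHighestWeight 𝕜 (ψ₁ + ψ₂) (v₁ ⊗ₜ[𝕜] v₂) where
  lie_e x := by
    rw [TensorProduct.LieModule.lie_tmul_right, hv₁.lie_e, hv₂.lie_e, TensorProduct.zero_tmul,
      TensorProduct.tmul_zero, add_zero]
  lie_h z := by
    rw [TensorProduct.LieModule.lie_tmul_right, hv₁.lie_h, hv₂.lie_h, TensorProduct.tmul_smul,
      ← TensorProduct.smul_tmul', Pi.add_apply, add_smul]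
  lowerSpan_eq_top := by
    set S := t.lowerSpan 𝕜 {v₁ ⊗ₜ[𝕜] v₂}
    have hleft : ∀ w₁ : V₁, w₁ ⊗ₜ[𝕜] v₂ ∈ S := by
      suffices S.comap ((TensorProduct.mk 𝕜 V₁ V₂).flip v₂) = ⊤ from
        fun w₁ => this.ge (Submodule.mem_top (x := w₁))
      refine hv₁.eq_top (t.subset_lowerSpan _ rfl) fun x w hw => ?_
      obtain ⟨y, hy₁, hy₂⟩ := h₁.lie_f x
      have := t.lie_f_mem_lowerSpan y hw
      simpa [TensorProduct.LieModule.lie_tmul_right, hy₁, hy₂] using this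
    have hpure : ∀ (w₁ : V₁) (w₂ : V₂), w₁ ⊗ₜ[𝕜] w₂ ∈ S := by
      intro w₁
      suffices S.comap (TensorProduct.mk 𝕜 V₁ V₂ w₁) = ⊤ from
        fun w₂ => this.ge (Submodule.mem_top (x := w₂))
      refine hv₂.eq_top (hleft w₁) fun x w hw => ?_
      obtain ⟨y, hy₂, hy₁⟩ := h₂.lie_f x
      have := t.lie_f_mem_lowerSpan y hw
      simpa [TensorProduct.LieModule.lie_tmul_right, hy₁, hy₂] using this
    rw [eq_top_iff, ← TensorProduct.span_tmul_eq_top, Submodule.span_le]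
    rintro _ ⟨w₁, w₂, rfl⟩
    exact hpure w₁ w₂

lemma isIrreducible_tmul [CharZero 𝕜] [LieModule.IsIrreducible 𝕜 L V₁]
    [LieModule.IsIrreducible 𝕜 L V₂] (ht : t.span 𝕜 = ⊤) :
    LieModule.IsIrreducible 𝕜 L (V₁ ⊗[𝕜] V₂) := by
  refine (hv₁.tmul hv₂ h₁ h₂).isIrreducible ((tmul_eq_zero_iff hv₁.ne_zero).not.2 hv₂.ne_zero)
    fun w hw => ?_
  obtain ⟨u, rfl⟩ : ∃ u, w = v₁ ⊗ₜ[𝕜] u := by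
    refine exists_eq_tmul_of_rTensor_eq_zero (T := fun x => LieModule.toEnd 𝕜 L V₁ (t.e x))
      (fun w => hv₁.exists_eq_smul ht) fun x => ?_
    obtain ⟨y, hy₁, hy₂⟩ := h₁.lie_e x
    rw [show LieModule.toEnd 𝕜 L V₁ (t.e x) = LieModule.toEnd 𝕜 L V₁ (t.e y) from
      LinearMap.ext fun w => (hy₁ w).symm, ← lie_eq_rTensor hy₂, hw]
  have hu : ∀ x, ⁅t.e x, u⁆ = 0 := fun x => by
    simpa [TensorProduct.LieModule.lie_tmul_right, hv₁.lie_e, tmul_eq_zero_iff hv₁.ne_zero]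
      using hw x
  obtain ⟨a, rfl⟩ := hv₂.exists_eq_smul ht hu
  exact ⟨a, TensorProduct.tmul_smul a v₁ v₂⟩

end IsCyclicHighestWeight
end TriangularData.Generators

lemma freeLieAlgebra_lieSpan_of (𝕜 X : Type*) [CommRing 𝕜] :
    LieSubalgebra.lieSpan 𝕜 (FreeLieAlgebra 𝕜 X) (Set.range (FreeLieAlgebra.of 𝕜)) = ⊤ := by
  set S := LieSubalgebra.lieSpan 𝕜 (FreeLieAlgebra 𝕜 X) (Set.range (FreeLieAlgebra.of 𝕜))
  let φ : FreeLieAlgebra 𝕜 X →ₗ⁅𝕜⁆ S :=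
    FreeLieAlgebra.lift 𝕜 fun x => ⟨FreeLieAlgebra.of 𝕜 x, LieSubalgebra.subset_lieSpan ⟨x, rfl⟩⟩
  have h : S.incl.comp φ = LieHom.id := FreeLieAlgebra.hom_ext (by simp [φ])
  refine eq_top_iff.2 fun a _ => ?_
  have ha : ((φ a : S) : FreeLieAlgebra 𝕜 X) = a := DFunLike.congr_fun h a
  exact ha ▸ (φ a).2

lemma exists_forall_dual_apply_eq {𝕜 ι H : Type*} [Field 𝕜] [AddCommGroup H] [Module 𝕜 H]
    [Module.Finite 𝕜 H] {f : ι → Module.Dual 𝕜 H} (hf : LinearIndependent 𝕜 f) (c : ι → 𝕜) :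
    ∃ x, ∀ i, f i x = c i := by
  let β := Module.Basis.span hf
  obtain ⟨Φ, hΦ⟩ := LinearMap.exists_extend (β.constr 𝕜 c)
  refine ⟨(Module.evalEquiv 𝕜 H).symm Φ, fun i => ?_⟩
  have h := LinearMap.congr_fun hΦ (β i)
  rwa [β.constr_basis, LinearMap.comp_apply, Submodule.subtype_apply, Module.Basis.span_apply,
    ← Module.apply_evalEquiv_symm_apply] at h

section Chevalley

variable {ι : Type*} [Fintype ι] [DecidableEq ι] {C : Matrix ι ι ℤ}
  {H : Type*} [AddCommGroup H] [Module ℂ H] (R : Realization C H)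

/-- The positive Chevalley generators of `𝔤`. -/
def kmE (i : ι) : KM R := kmMk R (auxMk R (fe H i))

/-- The negative Chevalley generators of `𝔤`. -/
def kmF (i : ι) : KM R := kmMk R (auxMk R (ff H i))

/-- The canonical map from `H` onto the Cartan subalgebra of `𝔤`. -/
def kmH : H →ₗ[ℂ] KM R := (kmMk R : Aux R →ₗ[ℂ] KM R) ∘ₗ auxCartanMap R

lemma kmH_apply (x : H) : kmH R x = kmMk R (auxMk R (fh ι x)) := rfl

variable {R} in
lemma auxMk_eq_zero {a : FreeLieAlgebra ℂ (Gen ι H)} (h : Rel R a) : auxMk R a = 0 :=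
  (LieSubmodule.Quotient.mk_eq_zero _).2 (LieSubmodule.subset_lieSpan h)

lemma lie_kmH_kmH (x y : H) : ⁅kmH R x, kmH R y⁆ = 0 := by
  rw [kmH_apply, kmH_apply, ← LieHom.map_lie, ← LieHom.map_lie, auxMk_eq_zero (.hh x y), map_zero]

lemma lie_kmH_kmE (x : H) (i : ι) : ⁅kmH R x, kmE R i⁆ = R.root i x • kmE R i := by
  have h := auxMk_eq_zero (.he x i : Rel R _)
  rw [map_sub, map_smul, sub_eq_zero] at h
  rw [kmH_apply, kmE, ← LieHom.map_lie, ← LieHom.map_lie, h, map_smul]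

lemma lie_kmH_kmF (x : H) (i : ι) : ⁅kmH R x, kmF R i⁆ = -(R.root i x • kmF R i) := by
  have h := auxMk_eq_zero (.hf x i : Rel R _)
  rw [map_add, map_smul, add_eq_zero_iff_eq_neg] at h
  rw [kmH_apply, kmF, ← LieHom.map_lie, ← LieHom.map_lie, h, map_neg, map_smul]

lemma lie_kmE_kmF (i : ι) : ⁅kmE R i, kmF R i⁆ = kmH R (R.coroot i) := by
  have h := auxMk_eq_zero (.ef i : Rel R _)
  rw [map_sub, sub_eq_zero] at h
  rw [kmH_apply, kmE, kmF, ← LieHom.map_lie, ← LieHom.map_lie, h]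

lemma lie_kmE_kmF_of_ne {i j : ι} (hij : i ≠ j) : ⁅kmE R i, kmF R j⁆ = 0 := by
  rw [kmE, kmF, ← LieHom.map_lie, ← LieHom.map_lie, auxMk_eq_zero (.ef_ne i j hij), map_zero]

lemma km_lieSpan : LieSubalgebra.lieSpan ℂ (KM R)
    (Set.range (kmE R) ∪ Set.range (kmF R) ∪ Set.range (kmH R)) = ⊤ := by
  set S := LieSubalgebra.lieSpan ℂ (KM R)
    (Set.range (kmE R) ∪ Set.range (kmF R) ∪ Set.range (kmH R))
  have h : ⊤ ≤ S.comap ((kmMk R).comp (auxMk R)) := by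
    rw [← freeLieAlgebra_lieSpan_of, LieSubalgebra.lieSpan_le]
    rintro _ ⟨i | i | x, rfl⟩
    exacts [LieSubalgebra.subset_lieSpan (.inl (.inl ⟨i, rfl⟩)),
      LieSubalgebra.subset_lieSpan (.inl (.inr ⟨i, rfl⟩)),
      LieSubalgebra.subset_lieSpan (.inr ⟨x, rfl⟩)]
  refine eq_top_iff.2 fun a _ => ?_
  obtain ⟨a, rfl⟩ : ∃ b, kmMk R b = a := Submodule.Quotient.mk_surjective _ a
  obtain ⟨a, rfl⟩ : ∃ b, auxMk R b = a := Submodule.Quotient.mk_surjective _ a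
  exact h (LieSubalgebra.mem_top a)

/-- The subalgebra of `𝔤` generated by the Chevalley generators. -/
def chevalleySpan : LieSubalgebra ℂ (KM R) :=
  LieSubalgebra.lieSpan ℂ (KM R) (Set.range (kmE R) ∪ Set.range (kmF R))

lemma kmE_mem_chevalleySpan (i : ι) : kmE R i ∈ chevalleySpan R :=
  LieSubalgebra.subset_lieSpan (.inl ⟨i, rfl⟩)

lemma kmF_mem_chevalleySpan (i : ι) : kmF R i ∈ chevalleySpan R :=
  LieSubalgebra.subset_lieSpan (.inr ⟨i, rfl⟩)

lemma lie_kmH_mem_chevalleySpan (x : H) {a : KM R} (ha : a ∈ chevalleySpan R) :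
    ⁅kmH R x, a⁆ ∈ chevalleySpan R := by
  refine lie_mem_lieSpan_of_forall ?_ ha
  rintro _ (⟨i, rfl⟩ | ⟨i, rfl⟩)
  · exact lie_kmH_kmE R x i ▸ (chevalleySpan R).smul_mem _ (kmE_mem_chevalleySpan R i)
  · exact lie_kmH_kmF R x i ▸ neg_mem ((chevalleySpan R).smul_mem _ (kmF_mem_chevalleySpan R i))

lemma lie_mem_chevalleySpan_of_mem_sup {a b : KM R}
    (ha : a ∈ (chevalleySpan R).toSubmodule ⊔ (kmH R).range)
    (hb : b ∈ (chevalleySpan R).toSubmodule ⊔ (kmH R).range) : ⁅a, b⁆ ∈ chevalleySpan R := by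
  obtain ⟨a, ha', _, ⟨x, rfl⟩, rfl⟩ := Submodule.mem_sup.1 ha
  obtain ⟨b, hb', _, ⟨y, rfl⟩, rfl⟩ := Submodule.mem_sup.1 hb
  rw [lie_add, add_lie, add_lie, lie_kmH_kmH, add_zero, ← lie_skew a (kmH R y)]
  exact add_mem (add_mem (LieSubalgebra.lie_mem _ ha' hb') (lie_kmH_mem_chevalleySpan R x hb'))
    (neg_mem (lie_kmH_mem_chevalleySpan R y ha'))

lemma chevalleySpan_sup_range : (chevalleySpan R).toSubmodule ⊔ (kmH R).range = ⊤ := by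
  have hs : Set.range (kmE R) ∪ Set.range (kmF R) ∪ Set.range (kmH R) ⊆
      ((chevalleySpan R).toSubmodule ⊔ (kmH R).range : Submodule ℂ (KM R)) := by
    rintro _ ((⟨i, rfl⟩ | ⟨i, rfl⟩) | ⟨x, rfl⟩)
    exacts [Submodule.mem_sup_left (kmE_mem_chevalleySpan R i),
      Submodule.mem_sup_left (kmF_mem_chevalleySpan R i), Submodule.mem_sup_right ⟨x, rfl⟩]
  have h := lieSpan_le_of_forall_lie_mem hs fun g hg a ha =>
    Submodule.mem_sup_left (lie_mem_chevalleySpan_of_mem_sup R (hs hg) ha)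
  rwa [km_lieSpan, LieSubalgebra.top_toSubmodule, top_le_iff] at h

lemma derived_le_chevalleySpan : (derived R).toSubmodule ≤ (chevalleySpan R).toSubmodule := by
  rw [derived, LieSubmodule.lieIdeal_oper_eq_linear_span', Submodule.span_le]
  rintro _ ⟨a, -, b, -, rfl⟩
  exact lie_mem_chevalleySpan_of_mem_sup R ((chevalleySpan_sup_range R).ge Submodule.mem_top)
    ((chevalleySpan_sup_range R).ge Submodule.mem_top)

lemma lie_mem_derived (a b : KM R) : ⁅a, b⁆ ∈ derived R :=
  LieSubmodule.lie_mem_lie (LieSubmodule.mem_top a) (LieSubmodule.mem_top b)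

lemma kmE_mem_derived (i : ι) : kmE R i ∈ derived R := by
  have := R.finite
  obtain ⟨x, hx⟩ := exists_forall_dual_apply_eq R.root_indep 1
  have h := lie_mem_derived R (kmH R x) (kmE R i)
  rwa [lie_kmH_kmE, hx, Pi.one_apply, one_smul] at h

lemma kmF_mem_derived (i : ι) : kmF R i ∈ derived R := by
  have := R.finite
  obtain ⟨x, hx⟩ := exists_forall_dual_apply_eq R.root_indep 1
  have h := lie_mem_derived R (kmH R x) (kmF R i)
  rwa [lie_kmH_kmF, hx, Pi.one_apply, one_smul, neg_mem_iff] at h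

lemma kmH_coroot_mem_cartan' (i : ι) : kmH R (R.coroot i) ∈ cartan' R :=
  ⟨⟨_, rfl⟩, lie_kmE_kmF R i ▸ lie_mem_derived R _ _⟩

end Chevalley

section ExtendScalars

variable {𝕜 A L H : Type*} [CommRing 𝕜] [CommRing A] [Algebra 𝕜 A] [LieRing L] [LieAlgebra 𝕜 L]
  [AddCommGroup H] [Module 𝕜 H]

variable (A) in
/-- The `A`-valued extension of a linear form. -/
def extendDual (ρ : Module.Dual 𝕜 H) : A ⊗[𝕜] H →ₗ[𝕜] A :=
  (TensorProduct.rid 𝕜 A).toLinearMap ∘ₗ ρ.lTensor A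

@[simp]
lemma extendDual_tmul (ρ : Module.Dual 𝕜 H) (p : A) (x : H) :
    extendDual A ρ (p ⊗ₜ x) = ρ x • p := by
  simp [extendDual]

lemma extendDual_neg (ρ : Module.Dual 𝕜 H) : extendDual A (-ρ) = -extendDual A ρ := by
  rw [extendDual, LinearMap.lTensor_neg, LinearMap.comp_neg, extendDual]

lemma lie_lTensor_tmul {κ : H →ₗ[𝕜] L} {ρ : Module.Dual 𝕜 H} {X : L}
    (h : ∀ x, ⁅κ x, X⁆ = ρ x • X) (z : A ⊗[𝕜] H) (p : A) :
    ⁅κ.lTensor A z, p ⊗ₜ[𝕜] X⁆ = (extendDual A ρ z * p) ⊗ₜ[𝕜] X := by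
  induction z using TensorProduct.induction_on with
  | zero => rw [map_zero, map_zero, zero_mul, TensorProduct.zero_tmul, zero_lie]
  | add a b ha hb => rw [map_add, map_add, add_mul, TensorProduct.add_tmul, ← ha, ← hb, add_lie]
  | tmul q x =>
    rw [LinearMap.lTensor_tmul, LieAlgebra.ExtendScalars.bracket_tmul, h, extendDual_tmul,
      smul_mul_assoc, TensorProduct.tmul_smul, TensorProduct.smul_tmul']

lemma lie_lTensor_lTensor {κ : H →ₗ[𝕜] L} (h : ∀ x y, ⁅κ x, κ y⁆ = 0) (z z' : A ⊗[𝕜] H) :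
    ⁅κ.lTensor A z, κ.lTensor A z'⁆ = 0 := by
  induction z' using TensorProduct.induction_on with
  | zero => rw [map_zero, lie_zero]
  | add a b ha hb => rw [map_add, lie_add, ha, hb, add_zero]
  | tmul q y =>
    rw [LinearMap.lTensor_tmul, lie_lTensor_tmul (ρ := 0) fun x => by
      rw [h, LinearMap.zero_apply, zero_smul]]
    simp [extendDual]

end ExtendScalars

section Loop

variable {ι : Type*} [Fintype ι] [DecidableEq ι] {C : Matrix ι ι ℤ}
  {H : Type*} [AddCommGroup H] [Module ℂ H] {n : ℕ} {R : Realization C H}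

lemma tmul_mem_tensorSub {S : Submodule ℂ (KM R)} (p : Laurent n) {a : KM R} (ha : a ∈ S) :
    p ⊗ₜ[ℂ] a ∈ tensorSub n S :=
  Submodule.tmul_mem_baseChange_of_mem p ha

lemma tensorSub_le {S : Submodule ℂ (KM R)} {T : Submodule ℂ (Laurent n ⊗[ℂ] KM R)}
    (h : ∀ p, ∀ a ∈ S, p ⊗ₜ[ℂ] a ∈ T) : tensorSub n S ≤ T := by
  rintro _ ⟨y, rfl⟩
  induction y using TensorProduct.induction_on with
  | zero => exact map_zero (LinearMap.baseChange (Laurent n) S.subtype) ▸ zero_mem T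
  | add a b ha hb => rw [map_add]; exact add_mem ha hb
  | tmul p a => exact h p a a.2

lemma tensorSub_mono {S T : Submodule ℂ (KM R)} (h : S ≤ T) : tensorSub n S ≤ tensorSub n T :=
  tensorSub_le fun p _ ha => tmul_mem_tensorSub p (h ha)

lemma tensorSub_lieSpan_le {s : Set (KM R)} {G : LieSubalgebra ℂ (Laurent n ⊗[ℂ] KM R)}
    (h : ∀ p, ∀ a ∈ s, p ⊗ₜ[ℂ] a ∈ G) :
    tensorSub n (LieSubalgebra.lieSpan ℂ (KM R) s).toSubmodule ≤ G.toSubmodule := by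
  refine tensorSub_le fun p a ha => ?_
  change p ⊗ₜ[ℂ] a ∈ G
  replace ha : a ∈ LieSubalgebra.lieSpan ℂ (KM R) s := ha
  induction ha using LieSubalgebra.lieSpan_induction generalizing p with
  | mem a ha => exact h p a ha
  | zero => rw [TensorProduct.tmul_zero]; exact zero_mem G
  | smul c a _ ih => rw [TensorProduct.tmul_smul]; exact SMulMemClass.smul_mem c (ih p)
  | add a b _ _ iha ihb => rw [TensorProduct.tmul_add]; exact add_mem (iha p) (ihb p)
  | lie a b _ _ iha ihb =>
    have := LieSubalgebra.lie_mem G (iha p) (ihb 1)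
    rwa [LieAlgebra.ExtendScalars.bracket_tmul, mul_one] at this

variable (n R) in
/-- The canonical map `A ⊗ H → A ⊗ 𝔤`. -/
def loopH : Laurent n ⊗[ℂ] H →ₗ[ℂ] Laurent n ⊗[ℂ] KM R :=
  (kmH R).lTensor (Laurent n)

lemma lie_loopH_tmul_kmE (z : Laurent n ⊗[ℂ] H) (p : Laurent n) (i : ι) :
    ⁅loopH n R z, p ⊗ₜ[ℂ] kmE R i⁆ = (extendDual (Laurent n) (R.root i) z * p) ⊗ₜ[ℂ] kmE R i :=
  lie_lTensor_tmul (fun x => lie_kmH_kmE R x i) z p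

lemma lie_loopH_tmul_kmF (z : Laurent n ⊗[ℂ] H) (p : Laurent n) (i : ι) :
    ⁅loopH n R z, p ⊗ₜ[ℂ] kmF R i⁆ =
      -((extendDual (Laurent n) (R.root i) z * p) ⊗ₜ[ℂ] kmF R i) := by
  have h (x : H) : ⁅kmH R x, kmF R i⁆ = (-R.root i) x • kmF R i := by
    rw [lie_kmH_kmF, LinearMap.neg_apply, neg_smul]
  refine (lie_lTensor_tmul h z p).trans ?_
  rw [extendDual_neg, LinearMap.neg_apply, neg_mul, TensorProduct.neg_tmul]

variable {W : Submodule ℂ (KM R)}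

variable (n R W) in
/-- The preimage of `𝔥_A` in `A ⊗ H`. -/
def loopCartan : Submodule ℂ (Laurent n ⊗[ℂ] H) :=
  (tensorSub n (cartan' R) ⊔ constSub n W).comap (loopH n R)

variable (n R W) in
/-- The canonical map onto `𝔥_A` from its preimage in `A ⊗ H`. -/
def loopCartanMap : loopCartan n R W →ₗ[ℂ] hA n R W :=
  ((loopH n R ∘ₗ (loopCartan n R W).subtype).codRestrict (gA n R W).toSubmodule
    fun z => sup_le_sup_right (tensorSub_mono inf_le_right) _ z.2).codRestrict (hA n R W)
    fun z => z.2

lemma loopCartanMap_surjective (hW : W ≤ cartan R) :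
    Function.Surjective (loopCartanMap n R W) := by
  rintro ⟨⟨y, hy⟩, hy'⟩
  have hle : tensorSub n (cartan' R) ⊔ constSub n W ≤ (loopH n R).range := by
    refine sup_le (tensorSub_le ?_) ?_
    · rintro p _ ⟨⟨x, rfl⟩, -⟩
      exact ⟨p ⊗ₜ x, rfl⟩
    · rintro _ ⟨w, hw, rfl⟩
      obtain ⟨x, rfl⟩ := hW hw
      exact ⟨1 ⊗ₜ x, rfl⟩
  obtain ⟨z, rfl⟩ := hle hy'
  exact ⟨⟨z, hy'⟩, rfl⟩

lemma exists_loopCartan_root_eq_one (hW : cartan R ≤ cartan' R ⊔ W) :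
    ∃ d : loopCartan n R W, ∀ i, extendDual (Laurent n) (R.root i) d = 1 := by
  have := R.finite
  obtain ⟨x, hx⟩ := exists_forall_dual_apply_eq R.root_indep 1
  obtain ⟨a, ha, b, hb, hab⟩ := Submodule.mem_sup.1 (hW ⟨x, rfl⟩ : kmH R x ∈ _)
  refine ⟨⟨1 ⊗ₜ x, ?_⟩, fun i => by rw [extendDual_tmul, hx, Pi.one_apply, one_smul]⟩
  change (1 : Laurent n) ⊗ₜ[ℂ] kmH R x ∈ tensorSub n (cartan' R) ⊔ constSub n W
  rw [← hab, TensorProduct.tmul_add]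
  exact add_mem (Submodule.mem_sup_left (tmul_mem_tensorSub 1 ha))
    (Submodule.mem_sup_right ⟨b, hb, rfl⟩)

variable (n R W) in
/-- The element `p ⊗ αᵢ^∨` of `A ⊗ H`, for the simple coroot `αᵢ^∨`. -/
def loopCoroot (i : ι) (p : Laurent n) : loopCartan n R W :=
  ⟨p ⊗ₜ R.coroot i, Submodule.mem_sup_left (tmul_mem_tensorSub p (kmH_coroot_mem_cartan' R i))⟩

variable (n R W) in
/-- The raising generator `eᵢ ⊗ p` of `𝔤_A`, where `x = (i, p)`. -/
def loopE (x : ι × Laurent n) : gA n R W :=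
  ⟨x.2 ⊗ₜ[ℂ] kmE R x.1, Submodule.mem_sup_left (tmul_mem_tensorSub _ (kmE_mem_derived R x.1))⟩

variable (n R W) in
/-- The lowering generator `fᵢ ⊗ p` of `𝔤_A`, where `x = (i, p)`. -/
def loopF (x : ι × Laurent n) : gA n R W :=
  ⟨x.2 ⊗ₜ[ℂ] kmF R x.1, Submodule.mem_sup_left (tmul_mem_tensorSub _ (kmF_mem_derived R x.1))⟩

lemma loopE_mem_nA (x : ι × Laurent n) : loopE n R W x ∈ nA n R W :=
  tmul_mem_tensorSub x.2 (LieSubalgebra.subset_lieSpan ⟨x.1, rfl⟩)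

lemma nA_le {G : LieSubalgebra ℂ (gA n R W)} (hG : ∀ x, loopE n R W x ∈ G) :
    nA n R W ≤ G.toSubmodule := by
  intro y hy
  have h : tensorSub n (nPlus R).toSubmodule ≤ (G.map (gA n R W).incl).toSubmodule := by
    refine tensorSub_lieSpan_le ?_
    rintro p _ ⟨i, rfl⟩
    exact ⟨loopE n R W (i, p), hG _, rfl⟩
  obtain ⟨y', hy', he⟩ := h hy
  exact (Subtype.ext he : y' = y) ▸ hy'

/-- The structure constants of `𝔤_A` relative to the generators `eᵢ ⊗ p`, `fᵢ ⊗ p` and `𝔥_A`; the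
principal grading is the one by `d`, on which all simple roots take the value one. -/
@[simps]
def loopData {d : loopCartan n R W} (hd : ∀ i, extendDual (Laurent n) (R.root i) d = 1) :
    TriangularData (ι × Laurent n) (loopCartan n R W) where
  act z x := (x.1, extendDual (Laurent n) (R.root x.1) z * x.2)
  pairing x y := if x.1 = y.1 then loopCoroot n R W x.1 (x.2 * y.2) else 0
  grading := d
  act_comm z z' x := Prod.ext rfl (mul_left_comm _ _ _)
  pairing_act z x y := by
    by_cases h : x.1 = y.1
    · simp only [h, if_true, mul_left_comm, mul_assoc]
    · simp only [h, if_false]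
  act_grading x := Prod.ext rfl (by rw [hd, one_mul])

variable {d : loopCartan n R W} (hd : ∀ i, extendDual (Laurent n) (R.root i) d = 1)

lemma lie_loopE_loopF (x y : ι × Laurent n) :
    ⁅loopE n R W x, loopF n R W y⁆ = loopCartanMap n R W ((loopData hd).pairing x y) := by
  refine Subtype.ext ?_
  change ⁅x.2 ⊗ₜ[ℂ] kmE R x.1, y.2 ⊗ₜ[ℂ] kmF R y.1⁆ = loopH n R ((loopData hd).pairing x y)
  rw [LieAlgebra.ExtendScalars.bracket_tmul, loopData_pairing]
  split_ifs with h
  · rw [← h, lie_kmE_kmF]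
    rfl
  · rw [lie_kmE_kmF_of_ne R h, TensorProduct.tmul_zero, ZeroMemClass.coe_zero, map_zero]

/-- The generators `eᵢ ⊗ p`, `fᵢ ⊗ p` and `𝔥_A` of `𝔤_A`. -/
@[simps]
def loopGenerators : (loopData hd).Generators (gA n R W) where
  e := loopE n R W
  f := loopF n R W
  h z := loopCartanMap n R W z
  lie_h_h _ _ := Subtype.ext (lie_lTensor_lTensor (lie_kmH_kmH R) _ _)
  lie_h_e _ _ := Subtype.ext (lie_loopH_tmul_kmE _ _ _)
  lie_h_f _ _ := Subtype.ext (lie_loopH_tmul_kmF _ _ _)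
  lie_e_f := lie_loopE_loopF hd

lemma loopGenerators_span (hW : W ≤ cartan R) : (loopGenerators hd).span ℂ = ⊤ := by
  set G := (loopGenerators hd).span ℂ
  have hderived : tensorSub n (derived R).toSubmodule ≤ (G.map (gA n R W).incl).toSubmodule := by
    refine (tensorSub_mono (derived_le_chevalleySpan R)).trans (tensorSub_lieSpan_le ?_)
    rintro p _ (⟨i, rfl⟩ | ⟨i, rfl⟩)
    · exact ⟨_, (loopGenerators hd).e_mem_span (i, p), rfl⟩
    · exact ⟨_, (loopGenerators hd).f_mem_span (i, p), rfl⟩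
  have hconst : constSub n W ≤ (G.map (gA n R W).incl).toSubmodule := by
    intro y hy
    obtain ⟨z, hz⟩ := loopCartanMap_surjective (n := n) hW
      ⟨⟨y, Submodule.mem_sup_right hy⟩, Submodule.mem_sup_right hy⟩
    exact ⟨_, (loopGenerators hd).h_mem_span z, congrArg (fun z => (z.1 : Laurent n ⊗[ℂ] KM R)) hz⟩
  refine eq_top_iff.2 fun y _ => ?_
  obtain ⟨y', hy', he⟩ := sup_le hderived hconst y.2
  exact (Subtype.ext he : y' = y) ▸ hy'

end Loop

section EnvelopingAlgebra

variable {𝕜 L V : Type*} [CommRing 𝕜] [LieRing L] [LieAlgebra 𝕜 L] [AddCommGroup V] [Module 𝕜 V]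

lemma subalgebra_eq_top_of_forall_ι_mem {S : Subalgebra 𝕜 (UniversalEnvelopingAlgebra 𝕜 L)}
    (h : ∀ x : L, UniversalEnvelopingAlgebra.ι 𝕜 x ∈ S) : S = ⊤ := by
  let ιS : L →ₗ⁅𝕜⁆ S :=
    { ((UniversalEnvelopingAlgebra.ι 𝕜 : L →ₗ⁅𝕜⁆ _) : L →ₗ[𝕜] _).codRestrict
        (Subalgebra.toSubmodule S) h with
      map_lie' := fun {x y} => Subtype.ext (LieHom.map_lie _ x y) }
  have hid : S.val.comp (UniversalEnvelopingAlgebra.lift 𝕜 ιS) = AlgHom.id 𝕜 _ := by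
    refine UniversalEnvelopingAlgebra.hom_ext 𝕜 (LieHom.ext fun x => ?_)
    exact congrArg S.val (UniversalEnvelopingAlgebra.lift_ι_apply 𝕜 ιS x)
  refine eq_top_iff.2 fun u _ => ?_
  rw [← AlgHom.id_apply (R := 𝕜) u, ← hid]
  exact (UniversalEnvelopingAlgebra.lift 𝕜 ιS u).2

/-- A representation of a Lie algebra as a module over the universal enveloping algebra. -/
abbrev envelopingModule (ρ : L →ₗ⁅𝕜⁆ Module.End 𝕜 V) :
    Module (UniversalEnvelopingAlgebra 𝕜 L) V :=
  Module.compHom V (UniversalEnvelopingAlgebra.lift 𝕜 ρ).toRingHom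

lemma envelopingModule_ι_smul (ρ : L →ₗ⁅𝕜⁆ Module.End 𝕜 V) (x : L) (w : V) :
    let _ := envelopingModule ρ
    UniversalEnvelopingAlgebra.ι 𝕜 x • w = ρ x w :=
  LinearMap.congr_fun (UniversalEnvelopingAlgebra.lift_ι_apply 𝕜 ρ x) w

lemma envelopingModule_isScalarTower (ρ : L →ₗ⁅𝕜⁆ Module.End 𝕜 V) :
    let _ := envelopingModule ρ
    IsScalarTower 𝕜 (UniversalEnvelopingAlgebra 𝕜 L) V :=
  let _ := envelopingModule ρ
  ⟨fun c u w => LinearMap.congr_fun (map_smul (UniversalEnvelopingAlgebra.lift 𝕜 ρ) c u) w⟩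

variable [Module (UniversalEnvelopingAlgebra 𝕜 L) V]
  [IsScalarTower 𝕜 (UniversalEnvelopingAlgebra 𝕜 L) V]

lemma smul_mem_of_forall_ι_smul_mem {S : Submodule 𝕜 V}
    (h : ∀ x : L, ∀ w ∈ S, UniversalEnvelopingAlgebra.ι 𝕜 x • w ∈ S)
    (u : UniversalEnvelopingAlgebra 𝕜 L) {w : V} (hw : w ∈ S) : u • w ∈ S := by
  let B : Subalgebra 𝕜 (UniversalEnvelopingAlgebra 𝕜 L) :=
    { carrier := {u | ∀ w ∈ S, u • w ∈ S}
      mul_mem' := fun {a b} ha hb w hw => by rw [mul_smul]; exact ha _ (hb w hw)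
      add_mem' := fun {a b} ha hb w hw => by rw [add_smul]; exact add_mem (ha w hw) (hb w hw)
      algebraMap_mem' := fun c w hw => by rw [algebraMap_smul]; exact S.smul_mem c hw }
  have hB : B = ⊤ := subalgebra_eq_top_of_forall_ι_mem h
  exact hB.ge (Algebra.mem_top (x := u)) w hw

variable [LieRingModule L V] (h : ∀ (x : L) (w : V), UniversalEnvelopingAlgebra.ι 𝕜 x • w = ⁅x, w⁆)

/-- The submodules over the universal enveloping algebra are the Lie submodules. -/
def submoduleOrderIso :
    Submodule (UniversalEnvelopingAlgebra 𝕜 L) V ≃o LieSubmodule 𝕜 L V where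
  toFun N := { N.restrictScalars 𝕜 with lie_mem := fun {x w} hw => h x w ▸ N.smul_mem _ hw }
  invFun N := { N.toAddSubgroup with
    smul_mem' := fun u _ hw => smul_mem_of_forall_ι_smul_mem (S := N.toSubmodule)
      (fun x w hw => (h x w).symm ▸ N.lie_mem hw) u hw }
  map_rel_iff' := Iff.rfl

include h in
lemma isSimpleModule_iff_isIrreducible :
    IsSimpleModule (UniversalEnvelopingAlgebra 𝕜 L) V ↔ LieModule.IsIrreducible 𝕜 L V :=
  (isSimpleModule_iff _ _).trans (submoduleOrderIso h).isSimpleOrder_iff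

end EnvelopingAlgebra

section Verma

variable {ι : Type*} [Fintype ι] [DecidableEq ι] {C : Matrix ι ι ℤ}
  {H : Type*} [AddCommGroup H] [Module ℂ H] {n : ℕ} {R : Realization C H}
  {W : Submodule ℂ (KM R)} (ψ : hA n R W →ₗ[ℂ] ℂ)

instance : LieRingModule (gA n R W) (M ψ) :=
  let _ : LieRingModule (UgA n R W) (M ψ) := LieRingModule.ofAssociativeModule
  LieRingModule.compLieHom (M ψ) (UniversalEnvelopingAlgebra.ι ℂ : gA n R W →ₗ⁅ℂ⁆ UgA n R W)

instance : LieModule ℂ (gA n R W) (M ψ) :=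
  let _ : LieRingModule (UgA n R W) (M ψ) := LieRingModule.ofAssociativeModule
  have := LieModule.ofAssociativeModule (R := ℂ) (A := UgA n R W) (M := M ψ)
  LieModule.compLieHom (M ψ) (UniversalEnvelopingAlgebra.ι ℂ : gA n R W →ₗ⁅ℂ⁆ UgA n R W)

/-- The canonical generator of `M(ψ)`. -/
def vermaGen : M ψ := (vermaIdeal ψ).mkQ 1

lemma smul_vermaGen (u : UgA n R W) : u • vermaGen ψ = (vermaIdeal ψ).mkQ u := by
  refine (((vermaIdeal ψ).mkQ).map_smul u 1).symm.trans ?_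
  rw [smul_eq_mul, mul_one]

lemma exists_smul_vermaGen (w : M ψ) : ∃ u : UgA n R W, u • vermaGen ψ = w := by
  obtain ⟨u, rfl⟩ := (vermaIdeal ψ).mkQ_surjective w
  exact ⟨u, smul_vermaGen ψ u⟩

lemma eq_top_of_vermaGen_mem {N : Submodule (UgA n R W) (M ψ)} (hN : vermaGen ψ ∈ N) : N = ⊤ := by
  refine eq_top_iff.2 fun w _ => ?_
  obtain ⟨u, rfl⟩ := exists_smul_vermaGen ψ w
  exact N.smul_mem u hN

lemma lie_loopE_vermaGen (x : ι × Laurent n) : ⁅loopE n R W x, vermaGen ψ⁆ = 0 :=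
  (smul_vermaGen ψ _).trans <| (Submodule.Quotient.mk_eq_zero _).2 <|
    Submodule.subset_span (Or.inl ⟨_, loopE_mem_nA x, rfl⟩)

lemma lie_loopCartanMap_vermaGen (z : loopCartan n R W) :
    ⁅(loopCartanMap n R W z : gA n R W), vermaGen ψ⁆ = ψ (loopCartanMap n R W z) • vermaGen ψ := by
  rw [← sub_eq_zero, ← algebraMap_smul (UgA n R W) (ψ _) (vermaGen ψ)]
  change UniversalEnvelopingAlgebra.ι ℂ (loopCartanMap n R W z : gA n R W) • vermaGen ψ - _ = 0
  rw [← sub_smul, smul_vermaGen]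
  exact (Submodule.Quotient.mk_eq_zero _).2 (Submodule.subset_span (Or.inr ⟨_, rfl⟩))

variable {ψ}

lemma vermaIdeal_le (hW : W ≤ cartan R) {J : Submodule (UgA n R W) (UgA n R W)}
    (he : ∀ x, UniversalEnvelopingAlgebra.ι ℂ (loopE n R W x) ∈ J)
    (hh : ∀ z, UniversalEnvelopingAlgebra.ι ℂ (loopCartanMap n R W z : gA n R W) -
      algebraMap ℂ (UgA n R W) (ψ (loopCartanMap n R W z)) ∈ J) : vermaIdeal ψ ≤ J := by
  let G : LieSubalgebra ℂ (gA n R W) :=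
    { (J.restrictScalars ℂ).comap
        ((UniversalEnvelopingAlgebra.ι ℂ : gA n R W →ₗ⁅ℂ⁆ UgA n R W) : _ →ₗ[ℂ] _) with
      lie_mem' := fun {x y} hx hy => by
        change UniversalEnvelopingAlgebra.ι ℂ ⁅x, y⁆ ∈ J
        rw [LieHom.map_lie, LieRing.of_associative_ring_bracket]
        exact sub_mem (J.smul_mem _ hy) (J.smul_mem _ hx) }
  rw [vermaIdeal, Submodule.span_le]
  rintro _ (⟨x, hx, rfl⟩ | ⟨h, rfl⟩)
  · exact nA_le (G := G) he hx
  · obtain ⟨z, rfl⟩ := loopCartanMap_surjective hW h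
    exact hh z

lemma exists_linearMap_vermaGen_eq (hW : W ≤ cartan R) {E : Type*} [AddCommGroup E] [Module ℂ E]
    [Module (UgA n R W) E] [IsScalarTower ℂ (UgA n R W) E] {v : E}
    (he : ∀ x, (UniversalEnvelopingAlgebra.ι ℂ (loopE n R W x) : UgA n R W) • v = 0)
    (hh : ∀ z, (UniversalEnvelopingAlgebra.ι ℂ (loopCartanMap n R W z : gA n R W) :
      UgA n R W) • v = ψ (loopCartanMap n R W z) • v) :
    ∃ φ : M ψ →ₗ[UgA n R W] E, φ (vermaGen ψ) = v := by
  refine ⟨(vermaIdeal ψ).liftQ (LinearMap.toSpanSingleton _ E v) (vermaIdeal_le hW he fun z => ?_),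
    (Submodule.liftQ_apply _ _ _).trans (one_smul _ v)⟩
  rw [LinearMap.mem_ker, LinearMap.toSpanSingleton_apply, sub_smul, hh, algebraMap_smul, sub_self]

variable {d : loopCartan n R W} (hd : ∀ i, extendDual (Laurent n) (R.root i) d = 1)
  (hW : W ≤ cartan R)
include hd hW

lemma vermaGen_isCyclicHighestWeight : (loopGenerators hd).IsCyclicHighestWeight ℂ
    (fun z => ψ (loopCartanMap n R W z)) (vermaGen ψ) where
  lie_e := lie_loopE_vermaGen ψ
  lie_h := lie_loopCartanMap_vermaGen ψ
  lowerSpan_eq_top := by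
    have hgen := (loopGenerators hd).subset_lowerSpan (𝕜 := ℂ) {vermaGen ψ} rfl
    refine eq_top_iff.2 fun w _ => ?_
    obtain ⟨u, rfl⟩ := exists_smul_vermaGen ψ w
    refine smul_mem_of_forall_ι_smul_mem (fun x w hw =>
      (loopGenerators hd).lie_mem_lowerSpan (loopGenerators_span hd hW) ?_ ?_ x hw) u hgen
    · rintro z _ rfl
      exact lie_loopCartanMap_vermaGen ψ z ▸ Submodule.smul_mem _ _ hgen
    · rintro x _ rfl
      exact lie_loopE_vermaGen ψ x ▸ zero_mem _

variable (ψ) in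
lemma vermaGen_ne_zero : vermaGen ψ ≠ 0 := by
  obtain ⟨χ, hχ⟩ := LinearMap.exists_extend ψ
  obtain ⟨Q, _, _, ρ, v, hv, he, hh⟩ :=
    exists_highestWeight_rep (loopGenerators hd) χ (loopGenerators_span hd hW)
  let _ := envelopingModule ρ
  have := envelopingModule_isScalarTower ρ
  obtain ⟨φ, rfl⟩ := exists_linearMap_vermaGen_eq (ψ := ψ) hW
    (fun x => (envelopingModule_ι_smul ρ _ v).trans (he x))
    (fun z => (envelopingModule_ι_smul ρ _ v).trans <| (hh z).trans <|
      congrArg (· • v) (LinearMap.congr_fun hχ (loopCartanMap n R W z)))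
  exact fun h => hv (h ▸ map_zero φ)

variable (ψ) in
lemma maxSubmodule_isCoatom : IsCoatom (maxSubmodule ψ) := by
  have hv := vermaGen_isCyclicHighestWeight (ψ := ψ) hd hW
  have hle : (maxSubmodule ψ).restrictScalars ℂ ≤ (loopGenerators hd).lowered ℂ (M ψ) := by
    refine (map_sSup (Submodule.restrictScalarsLatticeHom ℂ (UgA n R W) (M ψ)) _).trans_le
      (sSup_le ?_)
    rintro _ ⟨N, hN, rfl⟩
    exact hv.le_lowered (N := submoduleOrderIso (fun _ _ => rfl) N)
      fun h => hN (eq_top_of_vermaGen_mem ψ h)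
  refine ⟨fun h => ?_, fun N hN => not_not.1 fun h => hN.not_ge (le_sSup h)⟩
  exact hv.notMem_lowered (vermaGen_ne_zero ψ hd hW) (hle (h ▸ Submodule.mem_top))

variable (ψ) in
lemma V_isIrreducible : LieModule.IsIrreducible ℂ (gA n R W) (V ψ) :=
  (isSimpleModule_iff_isIrreducible (lie_def ψ · · |>.symm)).1
    (isSimpleModule_iff_isCoatom.2 (maxSubmodule_isCoatom ψ hd hW))

variable (ψ) in
lemma exists_V_isCyclicHighestWeight : ∃ v : V ψ, (loopGenerators hd).IsCyclicHighestWeight ℂ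
    (fun z => ψ (loopCartanMap n R W z)) v :=
  let π : M ψ →ₗ⁅ℂ, gA n R W⁆ V ψ :=
    { (maxSubmodule ψ).mkQ.restrictScalars ℂ with map_lie' := rfl }
  ⟨_, (vermaGen_isCyclicHighestWeight hd hW).map (φ := π) (maxSubmodule ψ).mkQ_surjective⟩

theorem nonempty_V_equiv {E : Type*} [AddCommGroup E] [Module ℂ E] [LieRingModule (gA n R W) E]
    [LieModule ℂ (gA n R W) E] [LieModule.IsIrreducible ℂ (gA n R W) E] {v : E}
    (hv : (loopGenerators hd).IsCyclicHighestWeight ℂ (fun z => ψ (loopCartanMap n R W z)) v) :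
    Nonempty (V ψ ≃ₗ⁅ℂ, gA n R W⁆ E) := by
  let ρ := LieModule.toEnd ℂ (gA n R W) E
  let _ := envelopingModule ρ
  have := envelopingModule_isScalarTower ρ
  have hρ := envelopingModule_ι_smul ρ
  have : IsSimpleModule (UgA n R W) E := (isSimpleModule_iff_isIrreducible hρ).2 inferInstance
  obtain ⟨φ, hφ⟩ := exists_linearMap_vermaGen_eq hW (fun x => (hρ _ v).trans (hv.lie_e x))
    (fun z => (hρ _ v).trans (hv.lie_h z))
  have hsurj : Function.Surjective φ :=
    LinearMap.surjective_of_ne_zero fun h => hv.ne_zero (by rw [← hφ, h, LinearMap.zero_apply])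
  have hker : maxSubmodule ψ = LinearMap.ker φ :=
    ((LinearMap.isCoatom_ker_of_surjective hsurj).le_iff_eq
      (maxSubmodule_isCoatom ψ hd hW).1).1 (le_sSup (LinearMap.isCoatom_ker_of_surjective hsurj).1)
  let θ : V ψ ≃ₗ[UgA n R W] E :=
    (Submodule.quotEquivOfEq _ _ hker).trans (φ.quotKerEquivOfSurjective hsurj)
  exact ⟨{ θ.restrictScalars ℂ with
    map_lie' := fun {x w} => (θ.map_smul (UniversalEnvelopingAlgebra.ι ℂ x) w).trans (hρ x _) }⟩

end Verma

section TensorProduct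

variable {ι : Type*} [Fintype ι] [DecidableEq ι] {C : Matrix ι ι ℤ}
  {H : Type*} [AddCommGroup H] [Module ℂ H] {n : ℕ} {R : Realization C H}
  {W : Submodule ℂ (KM R)}

lemma loopE_add (i : ι) (p q : Laurent n) :
    loopE n R W (i, p + q) = loopE n R W (i, p) + loopE n R W (i, q) :=
  Subtype.ext (TensorProduct.add_tmul p q _)

lemma loopF_add (i : ι) (p q : Laurent n) :
    loopF n R W (i, p + q) = loopF n R W (i, p) + loopF n R W (i, q) :=
  Subtype.ext (TensorProduct.add_tmul p q _)

variable {d : loopCartan n R W} (hd : ∀ i, extendDual (Laurent n) (R.root i) d = 1)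

lemma loopData_isIdeal {ψ : hA n R W →ₗ[ℂ] ℂ} {I : Ideal (Laurent n)}
    (hψ : ∀ h : cartan' R, ∀ p ∈ I, ψ (hTensor W h p) = 0) :
    (loopData hd).IsIdeal {x | x.2 ∈ I}
      {z : loopCartan n R W |
        (∀ i, extendDual (Laurent n) (R.root i) z ∈ I) ∧ ψ (loopCartanMap n R W z) = 0} := by
  have hpairing (x y : ι × Laurent n) (hxy : x.2 * y.2 ∈ I) : (loopData hd).pairing x y ∈
      {z : loopCartan n R W |
        (∀ i, extendDual (Laurent n) (R.root i) z ∈ I) ∧ ψ (loopCartanMap n R W z) = 0} := by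
    rw [loopData_pairing]
    split_ifs
    · refine ⟨fun i => ?_, hψ ⟨_, kmH_coroot_mem_cartan' R x.1⟩ _ hxy⟩
      rw [loopCoroot, extendDual_tmul]
      exact Submodule.smul_of_tower_mem I _ hxy
    · exact ⟨fun i => by simp, by simp⟩
  exact
    { act_mem := fun z x hx => I.mul_mem_left _ hx
      act_mem_of_mem := fun z hz x => I.mul_mem_right _ (hz.1 x.1)
      pairing_mem_left := fun x hx y => hpairing x y (I.mul_mem_right _ hx)
      pairing_mem_right := fun x y hy => hpairing x y (I.mul_mem_left _ hy) }

lemma isolates_of_sup_eq_top {V₁ V₂ : Type*} [AddCommGroup V₁] [Module ℂ V₁]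
    [LieRingModule (gA n R W) V₁] [LieModule ℂ (gA n R W) V₁]
    [LieModule.IsIrreducible ℂ (gA n R W) V₁] [AddCommGroup V₂] [Module ℂ V₂]
    [LieRingModule (gA n R W) V₂] [LieModule ℂ (gA n R W) V₂]
    [LieModule.IsIrreducible ℂ (gA n R W) V₂] (hW : W ≤ cartan R) {I₁ I₂ : Ideal (Laurent n)}
    (hI : I₁ ⊔ I₂ = ⊤) {ψ₁ ψ₂ : hA n R W →ₗ[ℂ] ℂ}
    (hψ₁ : ∀ h : cartan' R, ∀ p ∈ I₁, ψ₁ (hTensor W h p) = 0)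
    (hψ₂ : ∀ h : cartan' R, ∀ p ∈ I₂, ψ₂ (hTensor W h p) = 0) {v₁ : V₁} {v₂ : V₂}
    (hv₁ : (loopGenerators hd).IsCyclicHighestWeight ℂ (fun z => ψ₁ (loopCartanMap n R W z)) v₁)
    (hv₂ : (loopGenerators hd).IsCyclicHighestWeight ℂ (fun z => ψ₂ (loopCartanMap n R W z)) v₂) :
    (loopGenerators hd).Isolates V₁ V₂ := by
  have ht := loopGenerators_span hd hW
  have hS₁ := loopData_isIdeal hd hψ₁
  have hS₂ := loopData_isIdeal hd hψ₂
  have hdec (p : Laurent n) : ∃ a ∈ I₁, ∃ b ∈ I₂, a + b = p :=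
    Submodule.mem_sup.1 (hI.ge (Submodule.mem_top (x := p)))
  constructor
  · rintro ⟨i, p⟩
    obtain ⟨a, ha, b, hb, rfl⟩ := hdec p
    refine ⟨(i, b), fun w => ?_, hv₂.lie_e_eq_zero hS₂ (fun _ hz => hz.2) ht hb⟩
    have hzero : ⁅loopE n R W (i, a), w⁆ = 0 :=
      hv₁.lie_e_eq_zero hS₁ (fun _ hz => hz.2) ht (x := (i, a)) ha w
    simp only [loopGenerators_e, loopE_add, add_lie, hzero, zero_add]
  · rintro ⟨i, p⟩
    obtain ⟨a, ha, b, hb, rfl⟩ := hdec p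
    refine ⟨(i, b), fun w => ?_, hv₂.lie_f_eq_zero hS₂ (fun _ hz => hz.2) ht hb⟩
    have hzero : ⁅loopF n R W (i, a), w⁆ = 0 :=
      hv₁.lie_f_eq_zero hS₁ (fun _ hz => hz.2) ht (x := (i, a)) ha w
    simp only [loopGenerators_f, loopF_add, add_lie, hzero, zero_add]

end TensorProduct

end LoopKacMoody

end

open LoopKacMoody in
theorem proposition3p8_general {ι : Type*} [Fintype ι] [DecidableEq ι] {C : Matrix ι ι ℤ}
    {H : Type*} [AddCommGroup H] [Module ℂ H] {R : Realization C H}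
    {H'' : Submodule ℂ (KM R)} (hsup : cartan' R ⊔ H'' = cartan R)
    {n : ℕ} {I₁ I₂ : Ideal (Laurent n)} (hcop : I₁ ⊔ I₂ = ⊤)
    {ψ₁ ψ₂ : hA n R H'' →ₗ[ℂ] ℂ}
    (hψ₁ : ∀ h : cartan' R, ∀ p ∈ I₁, ψ₁ (hTensor H'' h p) = 0)
    (hψ₂ : ∀ h : cartan' R, ∀ p ∈ I₂, ψ₂ (hTensor H'' h p) = 0) :
    Nonempty (V (ψ₁ + ψ₂) ≃ₗ⁅ℂ, gA n R H''⁆ (V ψ₁ ⊗[ℂ] V ψ₂)) := by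
  have hW : H'' ≤ cartan R := hsup ▸ le_sup_right
  obtain ⟨d, hd⟩ := exists_loopCartan_root_eq_one (n := n) hsup.ge
  have := V_isIrreducible ψ₁ hd hW
  have := V_isIrreducible ψ₂ hd hW
  obtain ⟨v₁, hv₁⟩ := exists_V_isCyclicHighestWeight ψ₁ hd hW
  obtain ⟨v₂, hv₂⟩ := exists_V_isCyclicHighestWeight ψ₂ hd hW
  have h₁₂ := isolates_of_sup_eq_top hd hW hcop hψ₁ hψ₂ hv₁ hv₂
  have h₂₁ := isolates_of_sup_eq_top hd hW (sup_comm I₁ I₂ ▸ hcop) hψ₂ hψ₁ hv₂ hv₁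
  have := hv₁.isIrreducible_tmul hv₂ h₁₂ h₂₁ (loopGenerators_span hd hW)
  exact nonempty_V_equiv hd hW (hv₁.tmul hv₂ h₁₂ h₂₁)

theorem proposition3p8
    -- a Kac-Moody algebra `𝔤`: a generalized Cartan matrix and a realization of it
    {ι : Type*} [Fintype ι] [DecidableEq ι] (C : Matrix ι ι ℤ) (hC : LoopKacMoody.IsGCM C)
    {H : Type*} [AddCommGroup H] [Module ℂ H] (R : LoopKacMoody.Realization C H)
    -- a complement `𝔥''` of `𝔥'` in `𝔥`
    (H'' : Submodule ℂ (LoopKacMoody.KM R))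
    (hdisj : LoopKacMoody.cartan' R ⊓ H'' = ⊥)
    (hsup : LoopKacMoody.cartan' R ⊔ H'' = LoopKacMoody.cartan R)
    -- coprime cofinite ideals of the ring of Laurent polynomials in `n` variables
    (n : ℕ) (I₁ I₂ : Ideal (LoopKacMoody.Laurent n))
    (hfin₁ : Module.Finite ℂ (LoopKacMoody.Laurent n ⧸ I₁))
    (hfin₂ : Module.Finite ℂ (LoopKacMoody.Laurent n ⧸ I₂))
    (hcop : I₁ ⊔ I₂ = ⊤)
    (ψ₁ ψ₂ : LoopKacMoody.hA n R H'' →ₗ[ℂ] ℂ)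
    (hψ₁ : ∀ h : LoopKacMoody.cartan' R, ∀ p ∈ I₁, ψ₁ (LoopKacMoody.hTensor H'' h p) = 0)
    (hψ₂ : ∀ h : LoopKacMoody.cartan' R, ∀ p ∈ I₂, ψ₂ (LoopKacMoody.hTensor H'' h p) = 0) :
    Nonempty (LoopKacMoody.V (ψ₁ + ψ₂) ≃ₗ⁅ℂ, LoopKacMoody.gA n R H''⁆
      (LoopKacMoody.V ψ₁ ⊗[ℂ] LoopKacMoody.V ψ₂)) :=
  proposition3p8_general hsup hcop hψ₁ hψ₂
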